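/- Let $d \ge 1$ and let $\nu$ be a Lévy measure on $\mathbb{R}$ (that is, $\nu(\{0\})=0$ and $\int (|z|^2\wedge 1)\,\nu(dz)<\infty$) with $m_2<\infty$, where $m_p:=\int_{\mathbb{R}\setminus\{0\}}|z|^p\,\nu(dz)$. Let $N$ be a Poisson random measure on $\mathbb{R}_+\times\mathbb{R}^d\times(\mathbb{R}\setminus\{0\})$, on a probability space, with intensity $\mu(dt,dx,dz)=dt\,dx\,\nu(dz)$, and put $\widehat N=N-\mu$. The associated Lévy white noise is $L(A)=\int_{A\times(\mathbb{R}\setminus\{0\})} z\,\widehat N(dt,dx,dz)$ for bounded Borel sets $A\subset\mathbb{R}_+\times\mathbb{R}^d$ (the $L^2$-integral with respect to the compensated Poisson random measure). The map $1_A\mapsto L(A)$ satisfies $\mathbb{E}[L(A)L(B)]=m_2|A\cap B|$ and extends by linearity and density to a map $\varphi\mapsto\int\varphi\,dL$ from $L^2(\mathbb{R}_+\times\mathbb{R}^d)$ to $L^2(\Omega)$. Let $T\ge 0$, let $\Phi\in L^2([0,T]\times\mathbb{R}^d)$ be deterministic and real-valued, and put $Z=\int_0^T\int_{\mathbb{R}^d}\Phi(t,x)\,L(dt,dx)$.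 (a) Let $p\ge 2$ be real. If $\Phi\in L^p([0,T]\times\mathbb{R}^d)$ and $m_p<\infty$, then $\mathbb{E}|Z|^p<\infty$. If moreover $\nu\ne 0$ and $\Phi$ is not almost everywhere zero on $[0,T]\times\mathbb{R}^d$, then the converse holds too, so that $$\mathbb{E}|Z|^p<\infty \iff \Phi\in L^p([0,T]\times\mathbb{R}^d)\ \text{ and }\ m_p<\infty .$$ (b) Let $g:\mathbb{R}\to[0,\infty)$ be a Borel measurable, locally integrable function that is sub-multiplicative, i.e. for some $a>0$, $g(x+y)\le a\,g(x)\,g(y)$ for all $x,y\in\mathbb{R}$. If $\mathbb{E}[g(Z)]<\infty$, then $$\int_0^T\int_{\mathbb{R}^d}\int_{\{|z\Phi(t,x)|>1\}} g\big(z\Phi(t,x)\big)\,\nu(dz)\,dx\,dt<\infty .$$ -/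

import Mathlib

open MeasureTheory ProbabilityTheory Filter Topology Set
open scoped ENNReal NNReal

noncomputable section

/-- Time-space `ℝ × ℝ^d`; the half space `ℝ₊ × ℝ^d` is `halfSpace d`. -/
abbrev SpaceTime (d : ℕ) : Type := ℝ × EuclideanSpace ℝ (Fin d)

/-- The set `ℝ₊ × ℝ^d`. -/
def halfSpace (d : ℕ) : Set (SpaceTime d) := Ici (0 : ℝ) ×ˢ univ

/-- The set `[0, T] × ℝ^d`. -/
def timeStrip (d : ℕ) (T : ℝ) : Set (SpaceTime d) := Icc (0 : ℝ) T ×ˢ univ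

/-- Lebesgue measure `dt dx` on `ℝ₊ × ℝ^d`. -/
def leb (d : ℕ) : Measure (SpaceTime d) := volume.restrict (halfSpace d)

/-- Lévy measures on `ℝ`: no mass at `0`, and `∫ (|z|² ∧ 1) ν(dz) < ∞`. -/
structure IsLevyMeasure (ν : Measure ℝ) : Prop where
  zero : ν {0} = 0
  lintegral_min_lt_top : ∫⁻ z, ENNReal.ofReal (min (|z| ^ 2) 1) ∂ν < ∞

/-- The absolute moment `m_p = ∫ |z|^p ν(dz)` of a Lévy measure, as an element of `[0, ∞]`. -/
def absMoment (ν : Measure ℝ) (p : ℝ) : ℝ≥0∞ := ∫⁻ z, ENNReal.ofReal (|z| ^ p) ∂ν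

/-- The intensity `dt dx ν(dz)`. It is carried by `ℝ₊ × ℝ^d × ℝ₀` with `ℝ₀ = ℝ \ {0}`, because
`dt dx` is carried by `ℝ₊ × ℝ^d` and `ν {0} = 0` for a Lévy measure. -/
def intensity (d : ℕ) (ν : Measure ℝ) : Measure (SpaceTime d × ℝ) := (leb d).prod ν

/-- `N` is a Poisson random measure of intensity `μ` on the probability space `(Ω, P)`:
`N(A)` has the Poisson distribution of mean `μ(A)` (the point mass at `∞` if `μ(A) = ∞`), and
the values of `N` on finitely many disjoint sets are independent. -/
structure IsPoissonRandomMeasure {Ω S : Type*} [MeasurableSpace Ω] [MeasurableSpace S]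
    (P : Measure Ω) (μ : Measure S) (N : Ω → Measure S) : Prop where
  measurable : ∀ A, MeasurableSet A → Measurable fun ω => N ω A
  law : ∀ A, MeasurableSet A → μ A ≠ ∞ →
    P.map (fun ω => N ω A) = (poissonMeasure (μ A).toNNReal).map (fun n : ℕ => (n : ℝ≥0∞))
  law_top : ∀ A, MeasurableSet A → μ A = ∞ → ∀ᵐ ω ∂P, N ω A = ∞
  indep : ∀ (n : ℕ) (A : Fin n → Set S), (∀ i, MeasurableSet (A i)) →
    Pairwise (fun i j => Disjoint (A i) (A j)) → iIndepFun (fun i ω => N ω (A i)) P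

section L2Integral

variable {Ω S : Type*} [MeasurableSpace Ω] [MeasurableSpace S]

/-- The simple function `∑ c • 1_A` given by a formal linear combination of sets. -/
def simpleFunction (g : Set S →₀ ℝ) (s : S) : ℝ := g.sum fun A c => A.indicator (fun _ => c) s

/-- The integral `∑ c M(A)` of the simple function `∑ c • 1_A`. -/
def simpleIntegral (M : Set S → Ω → ℝ) (g : Set S →₀ ℝ) (ω : Ω) : ℝ := g.sum fun A c => c * M A ω

/-- `X` is (a version of) the integral of `f` in the sense of the extension to `L²(m)`, by linearity
and density, of `1_A ↦ M(A) ∈ L²(P)`, `A ∈ 𝒜`: there are simple functions over sets of `𝒜` which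
converge to `f` in `L²(m)` and whose integrals converge to `X` in `L²(P)`. -/
def IsL2Integral (P : Measure Ω) (m : Measure S) (𝒜 : Set (Set S)) (M : Set S → Ω → ℝ)
    (f : S → ℝ) (X : Ω → ℝ) : Prop :=
  MemLp X 2 P ∧ ∃ g : ℕ → (Set S →₀ ℝ), (∀ n, ∀ A ∈ (g n).support, A ∈ 𝒜) ∧
    Tendsto (fun n => eLpNorm (fun s => simpleFunction (g n) s - f s) 2 m) atTop (𝓝 0) ∧
    Tendsto (fun n => eLpNorm (fun ω => simpleIntegral M (g n) ω - X ω) 2 P) atTop (𝓝 0)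

open Classical in
/-- A version of the integral of `f`, if there is one. -/
def l2Integral (P : Measure Ω) (m : Measure S) (𝒜 : Set (Set S)) (M : Set S → Ω → ℝ)
    (f : S → ℝ) : Ω → ℝ :=
  if h : ∃ X, IsL2Integral P m 𝒜 M f X then h.choose else 0

/-- The compensated measure `N(F) - μ(F)`, for sets `F` of finite intensity. -/
def compensated (μ : Measure S) (N : Ω → Measure S) (F : Set S) (ω : Ω) : ℝ :=
  (N ω F).toReal - (μ F).toReal

/-- The integral of `f ∈ L²(μ)` with respect to the compensated Poisson random measure. -/
def compensatedIntegral (P : Measure Ω) (μ : Measure S) (N : Ω → Measure S) (f : S → ℝ) : Ω → ℝ :=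
  l2Integral P μ {F | MeasurableSet F ∧ μ F ≠ ∞} (compensated μ N) f

end L2Integral

section LevyNoise

variable {Ω : Type*} [MeasurableSpace Ω] {d : ℕ}

/-- The Lévy white noise `L(A) = ∫_{A × ℝ₀} z (N - μ)(dt, dx, dz)`. -/
def levyNoise (P : Measure Ω) (ν : Measure ℝ) (N : Ω → Measure (SpaceTime d × ℝ))
    (A : Set (SpaceTime d)) : Ω → ℝ :=
  compensatedIntegral P (intensity d ν) N fun q => A.indicator (fun _ => q.2) q.1

/-- The integral `L(φ) = ∫ φ dL` over `ℝ₊ × ℝ^d`: the extension to `L²(ℝ₊ × ℝ^d)` of the map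
`1_A ↦ L(A)`, where `A` runs through the bounded Borel subsets of `ℝ₊ × ℝ^d`. -/
def levyIntegral (P : Measure Ω) (ν : Measure ℝ) (N : Ω → Measure (SpaceTime d × ℝ))
    (φ : SpaceTime d → ℝ) : Ω → ℝ :=
  l2Integral P (leb d) {A | MeasurableSet A ∧ Bornology.IsBounded A ∧ A ⊆ halfSpace d}
    (levyNoise P ν N) φ

/-- The integral `∫_0^T ∫_{ℝ^d} Φ(t, x) L(dt, dx)`. -/
def levyIntegralOn (P : Measure Ω) (ν : Measure ℝ) (N : Ω → Measure (SpaceTime d × ℝ)) (T : ℝ)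
    (Φ : SpaceTime d → ℝ) : Ω → ℝ :=
  levyIntegral P ν N ((timeStrip d T).indicator Φ)

end LevyNoise

/-- Sub-multiplicative functions: `g(x + y) ≤ a g(x) g(y)` for some constant `a > 0`. -/
def IsSubmultiplicative (g : ℝ → ℝ) : Prop :=
  ∃ a : ℝ, 0 < a ∧ ∀ x y, g (x + y) ≤ a * g x * g y

end

/-! By the isometry property, `Z` is the integral of `f(t,x,z) = z Φ(t,x)` against the compensated
Poisson measure (`isL2Integral_levyIntegral`), so it suffices to study the law of such an integral
`X` of `f ∈ L²(μ)`. Its characteristic function is `exp ∫ (e^{itf} - 1 - itf) dμ`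
(`charFun_isL2Integral`).

Split at `D = {|f| > 1}`, which has finite measure. The exponent splits accordingly, and the law of
`X` is the convolution of the law of the small-jump integral `Y`, of the compound Poisson law of the
large jumps, and of a point mass (`map_isL2Integral_eq_conv`). All estimates use this identity of
laws only.

For a submultiplicative weight `h` the three factors separate. `Y` has exponential moments. The
compound Poisson law integrates `h` as soon as the jump measure does, by an exponential series
(`lintegral_compoundPoisson_lt_top`); conversely its one-jump term dominates a positive multiple of
the jump measure (`lintegral_le_compoundPoisson`). The converse half gives (b): some fixed value of
`Y` leaves a finite integral, and submultiplicativity removes the resulting translation.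

For (a) the weight is `(1 + |x|)^p`. Since `p ≥ 2` and `f ∈ L²(μ)`, the set `{|f| ≤ 1}` always
contributes finitely, so the criterion is `∫ |f|^p dμ < ∞`. By Tonelli this integral is `‖Φ‖_p^p
m_p`, and when neither factor vanishes the product is finite only if both are. -/

noncomputable section

set_option linter.unusedSectionVars false

/-! ### Linearity of simple functions and their integrals. -/

section SimpleLinear

variable {Ω S : Type*}

lemma simpleFunction_add (g h : Set S →₀ ℝ) :
    simpleFunction (g + h) = simpleFunction g + simpleFunction h := by
  ext s
  simp only [simpleFunction, Pi.add_apply]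
  refine Finsupp.sum_add_index' (fun A => by simp) fun A b c => ?_
  by_cases hs : s ∈ A <;> simp [hs]

lemma simpleFunction_smul (c : ℝ) (g : Set S →₀ ℝ) :
    simpleFunction (c • g) = c • simpleFunction g := by
  ext s
  simp only [simpleFunction, Pi.smul_apply, smul_eq_mul]
  rw [Finsupp.sum_smul_index (fun A => by simp), Finsupp.mul_sum]
  refine Finsupp.sum_congr fun A _ => ?_
  by_cases hs : s ∈ A <;> simp [hs]

lemma simpleIntegral_add (M : Set S → Ω → ℝ) (g h : Set S →₀ ℝ) :
    simpleIntegral M (g + h) = simpleIntegral M g + simpleIntegral M h := by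
  ext ω
  simp only [simpleIntegral, Pi.add_apply]
  exact Finsupp.sum_add_index' (fun A => by simp) fun A b c => by ring

lemma simpleIntegral_smul (M : Set S → Ω → ℝ) (c : ℝ) (g : Set S →₀ ℝ) :
    simpleIntegral M (c • g) = c • simpleIntegral M g := by
  ext ω
  simp only [simpleIntegral, Pi.smul_apply, smul_eq_mul]
  rw [Finsupp.sum_smul_index (fun A => by simp), Finsupp.mul_sum]
  exact Finsupp.sum_congr fun A _ => by ring

lemma simpleFunction_eq_sum (g : Set S →₀ ℝ) :
    simpleFunction g = fun s => ∑ A ∈ g.support, g A * A.indicator (fun _ => (1 : ℝ)) s := by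
  ext s
  refine Finset.sum_congr rfl fun A _ => ?_
  by_cases hs : s ∈ A <;> simp [hs]

lemma simpleIntegral_eq_sum (M : Set S → Ω → ℝ) (g : Set S →₀ ℝ) :
    simpleIntegral M g = fun ω => ∑ A ∈ g.support, g A * M A ω := rfl

lemma support_add_mem {𝒜 : Set (Set S)} {g h : Set S →₀ ℝ} (hg : ∀ A ∈ g.support, A ∈ 𝒜)
    (hh : ∀ A ∈ h.support, A ∈ 𝒜) : ∀ A ∈ (g + h).support, A ∈ 𝒜 := by
  classical
  intro A hA
  rcases Finset.mem_union.1 (Finsupp.support_add hA) with h1 | h1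
  exacts [hg A h1, hh A h1]

lemma support_smul_mem {𝒜 : Set (Set S)} {g : Set S →₀ ℝ} (c : ℝ) (hg : ∀ A ∈ g.support, A ∈ 𝒜) :
    ∀ A ∈ (c • g).support, A ∈ 𝒜 :=
  fun A hA => hg A (Finsupp.support_smul hA)

end SimpleLinear

/-! ### Extension of isometries from simple functions to `L²`. -/

section L2Theory

variable {Ω S : Type*} [MeasurableSpace Ω] [MeasurableSpace S]

/-- A set function into `L²(P)` whose linear extension to simple functions scales the `L²(m)` norm
by the factor `K`. -/
structure IsScaledIsometry (P : Measure Ω) (m : Measure S) (𝒜 : Set (Set S)) (M : Set S → Ω → ℝ)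
    (K : ℝ≥0∞) : Prop where
  measurableSet : ∀ A ∈ 𝒜, MeasurableSet A
  measure_ne_top : ∀ A ∈ 𝒜, m A ≠ ∞
  memLp : ∀ A ∈ 𝒜, MemLp (M A) 2 P
  ne_top : K ≠ ∞
  eLpNorm_eq : ∀ g : Set S →₀ ℝ, (∀ A ∈ g.support, A ∈ 𝒜) →
    eLpNorm (simpleIntegral M g) 2 P = K * eLpNorm (simpleFunction g) 2 m

variable {P : Measure Ω} {m : Measure S} {𝒜 : Set (Set S)} {M : Set S → Ω → ℝ} {K : ℝ≥0∞}
  {f f' : S → ℝ} {X X' : Ω → ℝ}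

lemma memLp_simpleFunction {g : Set S →₀ ℝ} (h𝒜 : ∀ A ∈ 𝒜, MeasurableSet A ∧ m A ≠ ∞)
    (hg : ∀ A ∈ g.support, A ∈ 𝒜) : MemLp (simpleFunction g) 2 m := by
  rw [simpleFunction_eq_sum]
  refine memLp_finsetSum _ fun A hA => ?_
  exact (memLp_indicator_const 2 (h𝒜 A (hg A hA)).1 1 (Or.inr (h𝒜 A (hg A hA)).2)).const_mul _

omit [MeasurableSpace S] in
lemma memLp_simpleIntegral {g : Set S →₀ ℝ} (hM : ∀ A ∈ 𝒜, MemLp (M A) 2 P)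
    (hg : ∀ A ∈ g.support, A ∈ 𝒜) : MemLp (simpleIntegral M g) 2 P := by
  rw [simpleIntegral_eq_sum]
  exact memLp_finsetSum _ fun A hA => (hM A (hg A hA)).const_mul _

/-- `L²` limits determine the `L²` norm. -/
lemma tendsto_eLpNorm_of_tendsto_sub {α : Type*} [MeasurableSpace α] {m : Measure α}
    {u : ℕ → α → ℝ} {v : α → ℝ} (hu : ∀ n, MemLp (u n) 2 m) (hv : MemLp v 2 m)
    (h : Tendsto (fun n => eLpNorm (fun s => u n s - v s) 2 m) atTop (𝓝 0)) :
    Tendsto (fun n => eLpNorm (u n) 2 m) atTop (𝓝 (eLpNorm v 2 m)) := by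
  have h1 := (Lp.tendsto_Lp_iff_tendsto_eLpNorm'' u hu v hv).2 h
  have h2 := h1.enorm
  simpa [Lp.enorm_toLp] using h2

lemma tendsto_sub_of_tendsto {α : Type*} [MeasurableSpace α] {m : Measure α}
    {u u' : ℕ → α → ℝ} {v v' : α → ℝ} (hu : ∀ n, MemLp (u n) 2 m) (hv : MemLp v 2 m)
    (hu' : ∀ n, MemLp (u' n) 2 m) (hv' : MemLp v' 2 m)
    (h : Tendsto (fun n => eLpNorm (fun s => u n s - v s) 2 m) atTop (𝓝 0))
    (h' : Tendsto (fun n => eLpNorm (fun s => u' n s - v' s) 2 m) atTop (𝓝 0)) :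
    Tendsto (fun n => eLpNorm (fun s => (u n + u' n) s - (v + v') s) 2 m) atTop (𝓝 0) := by
  have h0 := h.add h'
  rw [add_zero] at h0
  refine tendsto_of_tendsto_of_tendsto_of_le_of_le tendsto_const_nhds h0 (fun _ => zero_le)
    fun n => ?_
  refine le_trans (le_of_eq ?_) (eLpNorm_add_le ((hu n).sub hv).aestronglyMeasurable
    ((hu' n).sub hv').aestronglyMeasurable (by norm_num))
  congr 1
  ext s
  simp only [Pi.add_apply]
  ring

lemma tendsto_smul_sub_of_tendsto {α : Type*} [MeasurableSpace α] {m : Measure α}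
    {u : ℕ → α → ℝ} {v : α → ℝ} (c : ℝ)
    (h : Tendsto (fun n => eLpNorm (fun s => u n s - v s) 2 m) atTop (𝓝 0)) :
    Tendsto (fun n => eLpNorm (fun s => (c • u n) s - (c • v) s) 2 m) atTop (𝓝 0) := by
  have h1 := ENNReal.Tendsto.const_mul (a := ‖c‖ₑ) h (Or.inr enorm_ne_top)
  rw [mul_zero] at h1
  refine h1.congr fun n => ?_
  rw [← eLpNorm_const_smul]
  congr 1
  ext s
  simp [mul_sub]

namespace IsScaledIsometry

variable (hM : IsScaledIsometry P m 𝒜 M K)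
include hM

lemma memLp_simpleFunction {g : Set S →₀ ℝ} (hg : ∀ A ∈ g.support, A ∈ 𝒜) :
    MemLp (simpleFunction g) 2 m :=
  _root_.memLp_simpleFunction (fun A hA => ⟨hM.measurableSet A hA, hM.measure_ne_top A hA⟩) hg

lemma memLp_simpleIntegral {g : Set S →₀ ℝ} (hg : ∀ A ∈ g.support, A ∈ 𝒜) :
    MemLp (simpleIntegral M g) 2 P :=
  _root_.memLp_simpleIntegral hM.memLp hg

/-- The integrals of an `L²(m)`-convergent sequence of simple functions converge in `L²(P)`. -/
lemma exists_tendsto (hf : MemLp f 2 m) (g : ℕ → (Set S →₀ ℝ))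
    (hg : ∀ n, ∀ A ∈ (g n).support, A ∈ 𝒜)
    (hgf : Tendsto (fun n => eLpNorm (fun s => simpleFunction (g n) s - f s) 2 m) atTop (𝓝 0)) :
    ∃ X, MemLp X 2 P ∧
      Tendsto (fun n => eLpNorm (fun ω => simpleIntegral M (g n) ω - X ω) 2 P) atTop (𝓝 0) := by
  have h1 := (Lp.tendsto_Lp_iff_tendsto_eLpNorm'' _ (fun n => hM.memLp_simpleFunction (hg n)) f
    hf).2 hgf
  have h2 := (Lp.cauchySeq_Lp_iff_cauchySeq_eLpNorm _).1 h1.cauchySeq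
  -- Differences of integrals are integrals of differences, so scaling by `K` carries the Cauchy
  -- property from `L²(m)` to `L²(P)`.
  have h3 : CauchySeq fun n => (hM.memLp_simpleIntegral (hg n)).toLp := by
    rw [Lp.cauchySeq_Lp_iff_cauchySeq_eLpNorm]
    have h4 := ENNReal.Tendsto.const_mul (a := K) h2 (Or.inr hM.ne_top)
    rw [mul_zero] at h4
    refine h4.congr fun n => ?_
    have e1 : ∀ i j : ℕ, simpleFunction (g i + (-1 : ℝ) • g j)
        = simpleFunction (g i) - simpleFunction (g j) := fun i j => by
      rw [simpleFunction_add, simpleFunction_smul]; simp [sub_eq_add_neg]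
    have e2 : ∀ i j : ℕ, simpleIntegral M (g i + (-1 : ℝ) • g j)
        = simpleIntegral M (g i) - simpleIntegral M (g j) := fun i j => by
      rw [simpleIntegral_add, simpleIntegral_smul]; simp [sub_eq_add_neg]
    have h5 := hM.eLpNorm_eq (g n.1 + (-1 : ℝ) • g n.2)
      (support_add_mem (hg _) (support_smul_mem _ (hg _)))
    rw [e1, e2] at h5
    rw [eLpNorm_congr_ae ((MemLp.coeFn_toLp (hM.memLp_simpleFunction (hg n.1))).sub
        (MemLp.coeFn_toLp (hM.memLp_simpleFunction (hg n.2)))),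
      eLpNorm_congr_ae ((MemLp.coeFn_toLp (hM.memLp_simpleIntegral (hg n.1))).sub
        (MemLp.coeFn_toLp (hM.memLp_simpleIntegral (hg n.2)))), h5]
  obtain ⟨Y, hY⟩ := cauchySeq_tendsto_of_complete h3
  refine ⟨Y, Lp.memLp Y, ?_⟩
  rw [← Lp.toLp_coeFn Y (Lp.memLp Y)] at hY
  exact (Lp.tendsto_Lp_iff_tendsto_eLpNorm'' _ _ _ (Lp.memLp Y)).1 hY

lemma exists_isL2Integral (hf : MemLp f 2 m) (g : ℕ → (Set S →₀ ℝ))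
    (hg : ∀ n, ∀ A ∈ (g n).support, A ∈ 𝒜)
    (hgf : Tendsto (fun n => eLpNorm (fun s => simpleFunction (g n) s - f s) 2 m) atTop (𝓝 0)) :
    ∃ X, IsL2Integral P m 𝒜 M f X := by
  obtain ⟨X, hX, h⟩ := hM.exists_tendsto hf g hg hgf
  exact ⟨X, hX, g, hg, hgf, h⟩

lemma eLpNorm_isL2Integral (hf : MemLp f 2 m) (hX : IsL2Integral P m 𝒜 M f X) :
    eLpNorm X 2 P = K * eLpNorm f 2 m := by
  obtain ⟨hXm, g, hg, hgf, hgX⟩ := hX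
  have h1 := tendsto_eLpNorm_of_tendsto_sub (fun n => hM.memLp_simpleFunction (hg n)) hf hgf
  have h2 := tendsto_eLpNorm_of_tendsto_sub (fun n => hM.memLp_simpleIntegral (hg n)) hXm hgX
  have h3 := ENNReal.Tendsto.const_mul (a := K) h1 (Or.inr hM.ne_top)
  refine tendsto_nhds_unique h2 (h3.congr fun n => ?_)
  rw [hM.eLpNorm_eq _ (hg n)]

lemma isL2Integral_add (hf : MemLp f 2 m) (hf' : MemLp f' 2 m) (hX : IsL2Integral P m 𝒜 M f X)
    (hX' : IsL2Integral P m 𝒜 M f' X') : IsL2Integral P m 𝒜 M (f + f') (X + X') := by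
  obtain ⟨hXm, g, hg, hgf, hgX⟩ := hX
  obtain ⟨hXm', g', hg', hgf', hgX'⟩ := hX'
  refine ⟨hXm.add hXm', fun n => g n + g' n, fun n => support_add_mem (hg n) (hg' n), ?_, ?_⟩
  · simp only [simpleFunction_add]
    exact tendsto_sub_of_tendsto (fun n => hM.memLp_simpleFunction (hg n)) hf
      (fun n => hM.memLp_simpleFunction (hg' n)) hf' hgf hgf'
  · simp only [simpleIntegral_add]
    exact tendsto_sub_of_tendsto (fun n => hM.memLp_simpleIntegral (hg n)) hXm
      (fun n => hM.memLp_simpleIntegral (hg' n)) hXm' hgX hgX'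

omit hM in
lemma isL2Integral_smul (c : ℝ) (hX : IsL2Integral P m 𝒜 M f X) :
    IsL2Integral P m 𝒜 M (c • f) (c • X) := by
  obtain ⟨hXm, g, hg, hgf, hgX⟩ := hX
  refine ⟨hXm.const_smul c, fun n => c • g n, fun n => support_smul_mem c (hg n), ?_, ?_⟩
  · simp only [simpleFunction_smul]
    exact tendsto_smul_sub_of_tendsto c hgf
  · simp only [simpleIntegral_smul]
    exact tendsto_smul_sub_of_tendsto c hgX

/-- The difference `X - X'` is an integral of `f - f = 0`, hence has norm zero. This makes the
arbitrary choice in `l2Integral` harmless. -/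
lemma isL2Integral_ae_unique (hf : MemLp f 2 m) (hX : IsL2Integral P m 𝒜 M f X)
    (hX' : IsL2Integral P m 𝒜 M f X') : X =ᵐ[P] X' := by
  have h1 := hM.isL2Integral_add hf (hf.const_smul (-1 : ℝ)) hX (isL2Integral_smul (-1) hX')
  have h2 := hM.eLpNorm_isL2Integral (hf.add (hf.const_smul (-1 : ℝ))) h1
  have h3 : f + (-1 : ℝ) • f = 0 := by simp
  rw [h3, eLpNorm_zero, mul_zero, eLpNorm_eq_zero_iff h1.1.1 (by norm_num)] at h2
  filter_upwards [h2] with ω hω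
  simp only [Pi.add_apply, Pi.smul_apply, smul_eq_mul, Pi.zero_apply] at hω
  linarith

/-- Integrals are closed under `L²` limits. -/
lemma isL2Integral_of_tendsto {u : ℕ → S → ℝ} {Y : ℕ → Ω → ℝ} (hu : ∀ n, MemLp (u n) 2 m)
    (hf : MemLp f 2 m) (hX : MemLp X 2 P) (hY : ∀ n, IsL2Integral P m 𝒜 M (u n) (Y n))
    (huf : Tendsto (fun n => eLpNorm (fun s => u n s - f s) 2 m) atTop (𝓝 0))
    (hYX : Tendsto (fun n => eLpNorm (fun ω => Y n ω - X ω) 2 P) atTop (𝓝 0)) :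
    IsL2Integral P m 𝒜 M f X := by
  -- Diagonal argument: one simple function approximates `u n` and, through its integral, `Y n`,
  -- both within `1/(n+1)`.
  have key : ∀ n : ℕ, ∃ g : Set S →₀ ℝ, (∀ A ∈ g.support, A ∈ 𝒜) ∧
      eLpNorm (fun s => simpleFunction g s - u n s) 2 m ≤ ((n : ℝ≥0∞) + 1)⁻¹ ∧
      eLpNorm (fun ω => simpleIntegral M g ω - Y n ω) 2 P ≤ ((n : ℝ≥0∞) + 1)⁻¹ := by
    intro n
    obtain ⟨-, g, hg, hgf, hgX⟩ := hY n
    have hpos : (0 : ℝ≥0∞) < ((n : ℝ≥0∞) + 1)⁻¹ :=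
      ENNReal.inv_pos.2 (by finiteness)
    obtain ⟨k, h1, h2⟩ := ((hgf.eventually (gt_mem_nhds hpos)).and
      (hgX.eventually (gt_mem_nhds hpos))).exists
    exact ⟨g k, hg k, h1.le, h2.le⟩
  choose g hg h1 h2 using key
  have hinv : Tendsto (fun n : ℕ => ((n : ℝ≥0∞) + 1)⁻¹) atTop (𝓝 0) := by
    have := (tendsto_add_atTop_iff_nat 1).2 ENNReal.tendsto_inv_nat_nhds_zero
    simpa using this
  refine ⟨hX, g, hg, ?_, ?_⟩
  · have h0 := hinv.add huf
    rw [add_zero] at h0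
    refine tendsto_of_tendsto_of_tendsto_of_le_of_le tendsto_const_nhds h0 (fun _ => zero_le)
      fun n => le_trans ?_ (add_le_add_left (h1 n) _)
    refine le_trans (le_of_eq ?_) (eLpNorm_add_le
      ((hM.memLp_simpleFunction (hg n)).sub (hu n)).1 ((hu n).sub hf).1 (by norm_num))
    congr 1
    ext s
    simp
  · have h0 := hinv.add hYX
    rw [add_zero] at h0
    refine tendsto_of_tendsto_of_tendsto_of_le_of_le tendsto_const_nhds h0 (fun _ => zero_le)
      fun n => le_trans ?_ (add_le_add_left (h2 n) _)
    refine le_trans (le_of_eq ?_) (eLpNorm_add_le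
      ((hM.memLp_simpleIntegral (hg n)).sub (hY n).1).1 ((hY n).1.sub hX).1 (by norm_num))
    congr 1
    ext s
    simp

end IsScaledIsometry

lemma IsL2Integral.congr (hX : IsL2Integral P m 𝒜 M f X) (hff' : f =ᵐ[m] f') :
    IsL2Integral P m 𝒜 M f' X := by
  obtain ⟨hXm, g, hg, hgf, hgX⟩ := hX
  refine ⟨hXm, g, hg, hgf.congr fun n => eLpNorm_congr_ae ?_, hgX⟩
  filter_upwards [hff'] with s hs
  rw [hs]

lemma isL2Integral_l2Integral (h : ∃ X, IsL2Integral P m 𝒜 M f X) :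
    IsL2Integral P m 𝒜 M f (l2Integral P m 𝒜 M f) := by
  rw [l2Integral, dif_pos h]
  exact h.choose_spec

end L2Theory

/-! ### Moments of the Poisson distribution. -/

section PoissonMoments

open Real Nat

/-- The identity `E[N a(N)] = r E[a(N+1)]`, from `n / n! = 1 / (n-1)!`; it produces the first two
moments. -/
lemma hasSum_poisson_weight_succ (r : ℝ≥0) {a : ℕ → ℝ} {s : ℝ}
    (h : HasSum (fun n => exp (-r) * r ^ n / (n)! * a (n + 1)) s) :
    HasSum (fun n => exp (-r) * r ^ n / (n)! * (n * a n)) (r * s) := by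
  rw [← hasSum_nat_add_iff' 1]
  simp only [Finset.range_one, Finset.sum_singleton, Nat.cast_zero, zero_mul, mul_zero, sub_zero]
  refine (h.mul_left (r : ℝ)).congr_fun fun n => ?_
  have h1 : ((n)! : ℝ) ≠ 0 := by positivity
  have h2 : (n : ℝ) + 1 ≠ 0 := by positivity
  rw [Nat.factorial_succ]
  push_cast
  field_simp
  ring

lemma hasSum_poisson_weight_id (r : ℝ≥0) :
    HasSum (fun n : ℕ => exp (-r) * r ^ n / (n)! * (n : ℝ)) r := by
  have h := hasSum_poisson_weight_succ r (a := fun _ => 1) (s := 1)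
    (by simpa using hasSum_one_poissonMeasure r)
  simpa only [mul_one] using h

lemma hasSum_poisson_weight_sq (r : ℝ≥0) :
    HasSum (fun n : ℕ => exp (-r) * r ^ n / (n)! * (n : ℝ) ^ 2) (r * (r + 1)) := by
  simp only [sq]
  refine hasSum_poisson_weight_succ r (a := fun n => (n : ℝ)) ?_
  simpa [mul_add] using (hasSum_poisson_weight_id r).add (hasSum_one_poissonMeasure r)

lemma memLp_two_cast_poissonMeasure (r : ℝ≥0) :
    MemLp (fun n : ℕ => (n : ℝ)) 2 (poissonMeasure r) := by
  rw [memLp_two_iff_integrable_sq .of_discrete, integrable_poissonMeasure_iff]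
  simpa using (hasSum_poisson_weight_sq r).summable

lemma integral_cast_poissonMeasure (r : ℝ≥0) : ∫ n : ℕ, (n : ℝ) ∂(poissonMeasure r) = r := by
  rw [integral_poissonMeasure]
  simpa using (hasSum_poisson_weight_id r).tsum_eq

lemma integral_sub_sq_poissonMeasure (r : ℝ≥0) :
    ∫ n : ℕ, ((n : ℝ) - r) ^ 2 ∂(poissonMeasure r) = r := by
  rw [integral_poissonMeasure]
  have h := ((hasSum_poisson_weight_sq r).add
    ((hasSum_poisson_weight_id r).mul_left (-2 * (r : ℝ)))).add
    ((hasSum_one_poissonMeasure r).mul_left ((r : ℝ) ^ 2))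
  have e : (r : ℝ) * (r + 1) + -2 * r * r + r ^ 2 * 1 = r := by ring
  rw [e] at h
  refine Eq.trans (tsum_congr fun n => ?_) h.tsum_eq
  rw [smul_eq_mul]
  ring

lemma hasSum_exp_poissonMeasure (r : ℝ≥0) (t : ℝ) :
    HasSum (fun n : ℕ => exp (-r) * r ^ n / (n)! * exp (t * n)) (exp (r * (exp t - 1))) := by
  have h := (NormedSpace.expSeries_div_hasSum_exp ((r : ℝ) * exp t)).mul_left (exp (-r))
  rw [← exp_eq_exp_ℝ, ← exp_add] at h
  convert! h using 1
  · ext n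
    rw [mul_pow, ← exp_nat_mul, mul_comm t]
    ring
  · ring_nf

lemma integrable_exp_poissonMeasure (r : ℝ≥0) (t : ℝ) :
    Integrable (fun n : ℕ => exp (t * n)) (poissonMeasure r) := by
  rw [integrable_poissonMeasure_iff]
  simpa using (hasSum_exp_poissonMeasure r t).summable

lemma integral_exp_poissonMeasure (r : ℝ≥0) (t : ℝ) :
    ∫ n : ℕ, exp (t * n) ∂(poissonMeasure r) = exp (r * (exp t - 1)) := by
  rw [integral_poissonMeasure]
  exact (hasSum_exp_poissonMeasure r t).tsum_eq

end PoissonMoments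

/-! ### Simple functions as combinations of level sets. -/

section SimpleFuncFinsupp

variable {S : Type*} [MeasurableSpace S]

/-- The non-zero values of a simple function. -/
def nonzeroRange (F : SimpleFunc S ℝ) : Finset ℝ := F.range.filter (· ≠ 0)

/-- A simple function as a formal linear combination of its non-trivial level sets. -/
def levelCombination (F : SimpleFunc S ℝ) : Set S →₀ ℝ :=
  ∑ y ∈ nonzeroRange F, Finsupp.single (F ⁻¹' {y}) y

lemma ne_zero_of_mem_nonzeroRange {F : SimpleFunc S ℝ} {y : ℝ} (hy : y ∈ nonzeroRange F) :
    y ≠ 0 := (Finset.mem_filter.1 hy).2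

/-- Omitting the level set of `0` changes no value, and leaves only sets of finite measure when `F`
is in `L²`. -/
lemma simpleFunction_levelCombination (F : SimpleFunc S ℝ) :
    simpleFunction (levelCombination F) = F := by
  classical
  ext s
  have h : simpleFunction (levelCombination F) s
      = ∑ y ∈ nonzeroRange F, (F ⁻¹' {y}).indicator (fun _ => y) s := by
    simp only [simpleFunction, levelCombination]
    rw [← Finsupp.sum_finsetSum_index (fun A => by simp) fun A b c => by
      by_cases hs : s ∈ A <;> simp [hs]]
    exact Finset.sum_congr rfl fun y _ => by simp
  rw [h]
  by_cases h0 : F s = 0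
  · rw [h0]
    refine Finset.sum_eq_zero fun y hy => indicator_of_notMem ?_ _
    intro hs
    exact ne_zero_of_mem_nonzeroRange hy (by rw [← h0]; exact hs.symm)
  · rw [Finset.sum_eq_single (F s)]
    · simp
    · intro y _ hy
      exact indicator_of_notMem (fun hs => hy hs.symm) _
    · intro hn
      exact absurd (Finset.mem_filter.2 ⟨F.mem_range_self s, h0⟩) hn

lemma simpleIntegral_levelCombination {Ω : Type*} (M : Set S → Ω → ℝ) (F : SimpleFunc S ℝ) :
    simpleIntegral M (levelCombination F)
      = fun ω => ∑ y ∈ nonzeroRange F, y * M (F ⁻¹' {y}) ω := by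
  ext ω
  simp only [simpleIntegral, levelCombination]
  rw [← Finsupp.sum_finsetSum_index (fun A => by simp) fun A b c => by ring]
  exact Finset.sum_congr rfl fun y _ => by simp

lemma mem_support_levelCombination {F : SimpleFunc S ℝ} {A : Set S}
    (hA : A ∈ (levelCombination F).support) : ∃ y, y ≠ 0 ∧ A = F ⁻¹' {y} := by
  classical
  obtain ⟨y, hy, hA'⟩ := Finset.mem_biUnion.1 (Finsupp.support_finsetSum hA)
  refine ⟨y, ne_zero_of_mem_nonzeroRange hy, ?_⟩
  exact Finset.mem_singleton.1 (Finsupp.support_single_subset hA')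

/-- Since `g 0 = 0`, the level set of `0`, possibly of infinite measure, drops out. The cases of
interest are `charExponent (t * x)` and `exp (t x) - 1 - t x`. -/
lemma SimpleFunc.integral_comp_eq_sum {E : Type*} [NormedAddCommGroup E] [NormedSpace ℝ E]
    [CompleteSpace E] {μ : Measure S} {F : SimpleFunc S ℝ} (hF : Integrable F μ) {g : ℝ → E}
    (hg : g 0 = 0) :
    ∫ s, g (F s) ∂μ = ∑ y ∈ nonzeroRange F, μ.real (F ⁻¹' {y}) • g y := by
  have hF' : Integrable (F.map g) μ :=
    SimpleFunc.integrable_iff_finMeasSupp.2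
      ((SimpleFunc.integrable_iff_finMeasSupp.1 hF).map hg)
  have h := SimpleFunc.integral_eq_integral (F.map g) hF'
  rw [SimpleFunc.map_integral F g hF hg] at h
  simp only [SimpleFunc.coe_map, Function.comp_apply] at h
  rw [← h, nonzeroRange, Finset.sum_filter]
  refine Finset.sum_congr rfl fun y _ => ?_
  by_cases hy : y = 0 <;> simp [hy, hg]

end SimpleFuncFinsupp

/-! ### Covariance and isometry of the compensated Poisson measure. -/

section Compensated

variable {Ω S : Type*} [MeasurableSpace Ω] [MeasurableSpace S] {P : Measure Ω}
  [IsProbabilityMeasure P] {μ : Measure S} {N : Ω → Measure S} {A B : Set S}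

namespace IsPoissonRandomMeasure

variable (hN : IsPoissonRandomMeasure P μ N)
include hN

lemma measurable_toReal (hA : MeasurableSet A) : Measurable fun ω => (N ω A).toReal :=
  (hN.measurable A hA).ennreal_toReal

lemma measurable_compensated (hA : MeasurableSet A) : Measurable (compensated μ N A) :=
  (hN.measurable_toReal hA).sub_const _

lemma map_toReal (hA : MeasurableSet A) (hμA : μ A ≠ ∞) :
    P.map (fun ω => (N ω A).toReal)
      = (poissonMeasure (μ A).toNNReal).map (fun n : ℕ => (n : ℝ)) := by
  have h := congrArg (Measure.map ENNReal.toReal) (hN.law A hA hμA)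
  rw [Measure.map_map ENNReal.measurable_toReal (hN.measurable A hA),
    Measure.map_map ENNReal.measurable_toReal .of_discrete] at h
  simpa [Function.comp_def] using h

lemma integral_comp_toReal (hA : MeasurableSet A) (hμA : μ A ≠ ∞) {φ : ℝ → ℝ}
    (hφ : Measurable φ) :
    ∫ ω, φ (N ω A).toReal ∂P = ∫ n : ℕ, φ n ∂(poissonMeasure (μ A).toNNReal) := by
  rw [← integral_map (f := φ) (hN.measurable_toReal hA).aemeasurable hφ.aestronglyMeasurable,
    hN.map_toReal hA hμA, integral_map .of_discrete hφ.aestronglyMeasurable]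

lemma integrable_comp_toReal (hA : MeasurableSet A) (hμA : μ A ≠ ∞) {φ : ℝ → ℝ}
    (hφ : Measurable φ)
    (h : Integrable (fun n : ℕ => φ n) (poissonMeasure (μ A).toNNReal)) :
    Integrable (fun ω => φ (N ω A).toReal) P := by
  refine Integrable.comp_measurable (g := φ) ?_ (hN.measurable_toReal hA)
  rw [hN.map_toReal hA hμA, integrable_map_measure hφ.aestronglyMeasurable .of_discrete]
  exact h

lemma ae_ne_top (hA : MeasurableSet A) (hμA : μ A ≠ ∞) : ∀ᵐ ω ∂P, N ω A ≠ ∞ := by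
  have h : ∀ᵐ x ∂(P.map fun ω => N ω A), x ≠ ∞ := by
    rw [hN.law A hA hμA, ae_map_iff (p := fun x : ℝ≥0∞ => x ≠ ∞) .of_discrete
      (measurableSet_singleton _).compl]
    exact ae_of_all _ fun n => ENNReal.natCast_ne_top n
  exact ae_of_ae_map (hN.measurable A hA).aemeasurable h

lemma memLp_toReal (hA : MeasurableSet A) (hμA : μ A ≠ ∞) :
    MemLp (fun ω => (N ω A).toReal) 2 P := by
  rw [memLp_two_iff_integrable_sq (hN.measurable_toReal hA).aestronglyMeasurable]
  exact hN.integrable_comp_toReal (φ := fun x => x ^ 2) hA hμA (by fun_prop)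
    ((memLp_two_iff_integrable_sq .of_discrete).1 (memLp_two_cast_poissonMeasure _))

lemma memLp_compensated (hA : MeasurableSet A) (hμA : μ A ≠ ∞) :
    MemLp (compensated μ N A) 2 P :=
  (hN.memLp_toReal hA hμA).sub (memLp_const _)

lemma integral_compensated (hA : MeasurableSet A) (hμA : μ A ≠ ∞) :
    ∫ ω, compensated μ N A ω ∂P = 0 := by
  simp only [compensated]
  rw [integral_sub ((hN.memLp_toReal hA hμA).integrable (by norm_num)) (integrable_const _),
    hN.integral_comp_toReal (φ := fun x => x) hA hμA measurable_id, integral_cast_poissonMeasure]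
  simp [ENNReal.toReal]

lemma integral_compensated_sq (hA : MeasurableSet A) (hμA : μ A ≠ ∞) :
    ∫ ω, compensated μ N A ω ^ 2 ∂P = μ.real A := by
  have h := hN.integral_comp_toReal (φ := fun x => (x - (μ A).toReal) ^ 2) hA hμA (by fun_prop)
  simp only [compensated]
  rw [h]
  exact integral_sub_sq_poissonMeasure (μ A).toNNReal

lemma indepFun_of_disjoint (hA : MeasurableSet A) (hB : MeasurableSet B) (hAB : Disjoint A B) :
    IndepFun (compensated μ N A) (compensated μ N B) P := by
  have h := hN.indep 2 ![A, B] (fun i => by fin_cases i <;> simpa)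
    (fun i j hij => by fin_cases i <;> fin_cases j <;> simp_all [hAB.symm])
  have h1 : IndepFun (fun ω => N ω A) (fun ω => N ω B) P := by
    simpa using h.indepFun (i := 0) (j := 1) (by decide)
  exact h1.comp (φ := fun x => x.toReal - (μ A).toReal) (ψ := fun x => x.toReal - (μ B).toReal)
    (by fun_prop) (by fun_prop)

lemma integral_compensated_mul_of_disjoint (hA : MeasurableSet A) (hμA : μ A ≠ ∞)
    (hB : MeasurableSet B) (hAB : Disjoint A B) :
    ∫ ω, compensated μ N A ω * compensated μ N B ω ∂P = 0 := by
  rw [(hN.indepFun_of_disjoint hA hB hAB).integral_fun_mul_eq_mul_integral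
    (hN.measurable_compensated hA).aestronglyMeasurable
    (hN.measurable_compensated hB).aestronglyMeasurable, hN.integral_compensated hA hμA, zero_mul]

/-- `toReal` is additive on finite values, so additivity is obtained off the null event where `N ω A
= ∞`. -/
lemma compensated_eq_inter_add_diff (hA : MeasurableSet A) (hμA : μ A ≠ ∞)
    (hB : MeasurableSet B) :
    ∀ᵐ ω ∂P, compensated μ N A ω = compensated μ N (A ∩ B) ω + compensated μ N (A \ B) ω := by
  filter_upwards [hN.ae_ne_top hA hμA] with ω hω
  simp only [compensated]
  have h1 := measure_inter_add_sdiff (μ := N ω) A hB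
  have h2 := measure_inter_add_sdiff (μ := μ) A hB
  rw [← h1, ENNReal.toReal_add (measure_ne_top_of_subset inter_subset_left hω)
    (measure_ne_top_of_subset sdiff_subset hω), ← h2,
    ENNReal.toReal_add (measure_ne_top_of_subset inter_subset_left hμA)
    (measure_ne_top_of_subset sdiff_subset hμA)]
  ring

/-- Split `A` and `B` along `A ∩ B`. Disjoint pieces are independent and centred, so only the square
of the common piece survives. -/
lemma integral_compensated_mul (hA : MeasurableSet A) (hμA : μ A ≠ ∞)
    (hB : MeasurableSet B) (hμB : μ B ≠ ∞) :
    ∫ ω, compensated μ N A ω * compensated μ N B ω ∂P = μ.real (A ∩ B) := by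
  have mI := hN.memLp_compensated (hA.inter hB) (measure_ne_top_of_subset inter_subset_left hμA)
  have mA := hN.memLp_compensated (hA.diff hB) (measure_ne_top_of_subset sdiff_subset hμA)
  have mB := hN.memLp_compensated (hB.diff hA) (measure_ne_top_of_subset sdiff_subset hμB)
  have e : ∀ᵐ ω ∂P, compensated μ N A ω * compensated μ N B ω
      = compensated μ N (A ∩ B) ω ^ 2
        + compensated μ N (A ∩ B) ω * compensated μ N (B \ A) ω
        + compensated μ N (A \ B) ω * compensated μ N (A ∩ B) ω
        + compensated μ N (A \ B) ω * compensated μ N (B \ A) ω := by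
    filter_upwards [hN.compensated_eq_inter_add_diff hA hμA hB,
      hN.compensated_eq_inter_add_diff hB hμB hA] with ω h1 h2
    rw [h1, h2, inter_comm B A]
    ring
  have i1 : Integrable (fun ω => compensated μ N (A ∩ B) ω ^ 2) P := mI.integrable_sq
  have i2 : Integrable (fun ω => compensated μ N (A ∩ B) ω * compensated μ N (B \ A) ω) P :=
    mI.integrable_mul mB
  have i3 : Integrable (fun ω => compensated μ N (A \ B) ω * compensated μ N (A ∩ B) ω) P :=
    mA.integrable_mul mI
  have i4 : Integrable (fun ω => compensated μ N (A \ B) ω * compensated μ N (B \ A) ω) P :=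
    mA.integrable_mul mB
  rw [integral_congr_ae e, integral_add (by fun_prop) i4, integral_add (by fun_prop) i3,
    integral_add i1 i2,
    hN.integral_compensated_sq (hA.inter hB) (measure_ne_top_of_subset inter_subset_left hμA),
    hN.integral_compensated_mul_of_disjoint (hA.inter hB)
      (measure_ne_top_of_subset inter_subset_left hμA) (hB.diff hA)
      (disjoint_sdiff_right.mono_left inter_subset_left),
    hN.integral_compensated_mul_of_disjoint (hA.diff hB)
      (measure_ne_top_of_subset sdiff_subset hμA) (hA.inter hB)
      (disjoint_sdiff_left.mono_right inter_subset_right),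
    hN.integral_compensated_mul_of_disjoint (hA.diff hB)
      (measure_ne_top_of_subset sdiff_subset hμA) (hB.diff hA)
      (disjoint_sdiff_left.mono_right sdiff_subset)]
  simp

/-- The compensated Poisson random measure is an isometry of `L²(μ)` into `L²(P)`. -/
lemma isScaledIsometry_compensated :
    IsScaledIsometry P μ {F | MeasurableSet F ∧ μ F ≠ ∞} (compensated μ N) 1 where
  measurableSet A hA := hA.1
  measure_ne_top A hA := hA.2
  memLp A hA := hN.memLp_compensated hA.1 hA.2
  ne_top := ENNReal.one_ne_top
  eLpNorm_eq g hg := by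
    have h1 : MemLp (simpleIntegral (compensated μ N) g) 2 P :=
      memLp_simpleIntegral (fun A hA => hN.memLp_compensated hA.1 hA.2) hg
    have h2 : MemLp (simpleFunction g) 2 μ := memLp_simpleFunction (fun A hA => hA) hg
    rw [one_mul, h1.eLpNorm_eq_integral_rpow_norm (by norm_num) (by norm_num),
      h2.eLpNorm_eq_integral_rpow_norm (by norm_num) (by norm_num)]
    congr 2
    simp only [ENNReal.toReal_ofNat, Real.rpow_ofNat, Real.norm_eq_abs, sq_abs]
    rw [simpleIntegral_eq_sum, simpleFunction_eq_sum]
    -- The sets may overlap, so both squared norms become double sums, matched term by term through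
    -- the covariance `μ(A ∩ B)`.
    simp only [sq, Finset.sum_mul_sum]
    have i1 : ∀ A ∈ g.support, ∀ B ∈ g.support, Integrable (fun ω =>
        g A * compensated μ N A ω * (g B * compensated μ N B ω)) P := fun A hA B hB =>
      ((hN.memLp_compensated (hg A hA).1 (hg A hA).2).const_mul _).integrable_mul
        ((hN.memLp_compensated (hg B hB).1 (hg B hB).2).const_mul _)
    have m2 : ∀ A ∈ g.support, MemLp (fun s => g A * A.indicator (fun _ => (1 : ℝ)) s) 2 μ :=
      fun A hA => (memLp_indicator_const 2 (hg A hA).1 1 (Or.inr (hg A hA).2)).const_mul _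
    have i2 : ∀ A ∈ g.support, ∀ B ∈ g.support, Integrable (fun s =>
        g A * A.indicator (fun _ => (1 : ℝ)) s * (g B * B.indicator (fun _ => (1 : ℝ)) s)) μ :=
      fun A hA B hB => (m2 A hA).integrable_mul (m2 B hB)
    rw [integral_finsetSum _ fun A hA => integrable_finsetSum _ fun B hB => i1 A hA B hB,
      integral_finsetSum _ fun A hA => integrable_finsetSum _ fun B hB => i2 A hA B hB]
    refine Finset.sum_congr rfl fun A hA => ?_
    rw [integral_finsetSum _ fun B hB => i1 A hA B hB,
      integral_finsetSum _ fun B hB => i2 A hA B hB]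
    refine Finset.sum_congr rfl fun B hB => ?_
    have e1 : ∀ ω, g A * compensated μ N A ω * (g B * compensated μ N B ω)
        = g A * g B * (compensated μ N A ω * compensated μ N B ω) := fun ω => by ring
    have e2 : ∀ s, g A * A.indicator (fun _ => (1 : ℝ)) s * (g B * B.indicator (fun _ => (1 : ℝ)) s)
        = g A * g B * (A ∩ B).indicator (fun _ => (1 : ℝ)) s := fun s => by
      by_cases hsA : s ∈ A <;> by_cases hsB : s ∈ B <;> simp [hsA, hsB]
    simp only [e1, e2]
    rw [integral_const_mul, integral_const_mul,
      hN.integral_compensated_mul (hg A hA).1 (hg A hA).2 (hg B hB).1 (hg B hB).2,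
      integral_indicator_const _ ((hg A hA).1.inter (hg B hB).1)]
    simp

end IsPoissonRandomMeasure

end Compensated

/-! ### Characteristic functions and exponential moments of compensated integrals. -/

/-- The exponent `e^{ix} - 1 - ix` of the compensated Poisson characteristic function. -/
def charExponent (x : ℝ) : ℂ := Complex.exp (x * Complex.I) - 1 - x * Complex.I

lemma charExponent_zero : charExponent 0 = 0 := by simp [charExponent]

lemma continuous_charExponent : Continuous charExponent := by
  unfold charExponent; fun_prop

/-- Taylor's bound for `|x| ≤ 1`, and `2 + |x| ≤ 3 x²` otherwise. A quadratic bound makes the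
exponent integrable for every `f ∈ L²(μ)`. -/
lemma norm_charExponent_le (x : ℝ) : ‖charExponent x‖ ≤ 3 * x ^ 2 := by
  rcases le_or_gt |x| 1 with h | h
  · have h1 := Complex.norm_exp_sub_one_sub_id_le (x := x * Complex.I) (by simpa using h)
    have h2 : ‖(x : ℂ) * Complex.I‖ ^ 2 = x ^ 2 := by simp
    rw [h2] at h1
    exact h1.trans (by nlinarith [sq_nonneg x])
  · have h1 : ‖charExponent x‖ ≤ 1 + 1 + |x| := by
      refine (norm_sub_le _ _).trans (add_le_add ((norm_sub_le _ _).trans (add_le_add ?_ ?_)) ?_)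
      · rw [Complex.norm_exp_ofReal_mul_I]
      · simp
      · simp
    have h2 : x ^ 2 = |x| ^ 2 := (sq_abs x).symm
    nlinarith

lemma integrable_charExponent {S : Type*} [MeasurableSpace S] {μ : Measure S} {f : S → ℝ}
    (hf : MemLp f 2 μ) (t : ℝ) : Integrable (fun s => charExponent (t * f s)) μ := by
  refine Integrable.mono' (g := fun s => 3 * t ^ 2 * f s ^ 2) (hf.integrable_sq.const_mul _)
    (continuous_charExponent.comp_aestronglyMeasurable (hf.1.const_mul t)) ?_
  refine ae_of_all _ fun s => (norm_charExponent_le _).trans (le_of_eq ?_)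
  ring

section Law

variable {Ω S : Type*} [MeasurableSpace Ω] [MeasurableSpace S] {P : Measure Ω}
  [IsProbabilityMeasure P] {μ : Measure S} {N : Ω → Measure S} {A B : Set S}

namespace IsPoissonRandomMeasure

variable (hN : IsPoissonRandomMeasure P μ N)
include hN

lemma charFun_compensated (hA : MeasurableSet A) (hμA : μ A ≠ ∞) (t : ℝ) :
    charFun (P.map (compensated μ N A)) t = Complex.exp (μ.real A • charExponent t) := by
  have h1 : compensated μ N A = (fun x => x + -(μ A).toReal) ∘ fun ω => (N ω A).toReal := by
    ext ω; simp [compensated, sub_eq_add_neg]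
  rw [h1, ← Measure.map_map (by fun_prop) (hN.measurable_toReal hA), charFun_map_add_const,
    hN.map_toReal hA hμA, charFun_map_cast_poissonMeasure, ← Complex.exp_add]
  congr 1
  have h2 : (((μ A).toNNReal : ℝ) : ℂ) = (μ.real A : ℂ) := rfl
  rw [h2]
  simp only [charExponent, Complex.real_smul, Real.inner_apply, ← measureReal_def]
  push_cast
  ring

lemma mgf_compensated (hA : MeasurableSet A) (hμA : μ A ≠ ∞) (t : ℝ) :
    mgf (compensated μ N A) P t = Real.exp (μ.real A * (Real.exp t - 1 - t)) := by
  have h1 : compensated μ N A = fun ω => (N ω A).toReal + -(μ A).toReal := by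
    ext ω; simp [compensated, sub_eq_add_neg]
  rw [h1, mgf_add_const, mgf,
    hN.integral_comp_toReal (φ := fun x => Real.exp (t * x)) hA hμA (by fun_prop),
    integral_exp_poissonMeasure, ← Real.exp_add]
  congr 1
  have h2 : ((μ A).toNNReal : ℝ) = μ.real A := rfl
  rw [h2, ← measureReal_def]
  ring

lemma integrable_exp_compensated (hA : MeasurableSet A) (hμA : μ A ≠ ∞) (t : ℝ) :
    Integrable (fun ω => Real.exp (t * compensated μ N A ω)) P := by
  have h := hN.integrable_comp_toReal (φ := fun x => Real.exp (t * x)) hA hμA (by fun_prop)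
    (integrable_exp_poissonMeasure _ t)
  refine (h.mul_const (Real.exp (-t * (μ A).toReal))).congr (ae_of_all _ fun ω => ?_)
  simp only [compensated]
  rw [← Real.exp_add]
  ring_nf

lemma iIndepFun_compensated {ι : Type*} [Fintype ι] {A : ι → Set S}
    (hA : ∀ i, MeasurableSet (A i)) (hd : Pairwise fun i j => Disjoint (A i) (A j)) :
    iIndepFun (fun i => compensated μ N (A i)) P := by
  let e := Fintype.equivFin ι
  have h := hN.indep (Fintype.card ι) (fun i => A (e.symm i)) (fun i => hA _)
    (fun i j hij => hd (e.symm.injective.ne hij))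
  have h1 : iIndepFun (fun i ω => N ω (A i)) P := by
    simpa using h.precomp e.injective
  exact h1.comp (fun i x => x.toReal - (μ (A i)).toReal) fun i => by fun_prop

lemma iIndepFun_levelSets (F : SimpleFunc S ℝ) :
    iIndepFun (fun (y : nonzeroRange F) ω => (y : ℝ) * compensated μ N (F ⁻¹' {(y : ℝ)}) ω) P := by
  have h := hN.iIndepFun_compensated (ι := nonzeroRange F) (A := fun y => F ⁻¹' {(y : ℝ)})
    (fun y => F.measurableSet_preimage _) (fun y z hyz => by
      refine Disjoint.preimage _ (disjoint_singleton.2 fun h => hyz (Subtype.ext h)))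
  exact h.comp (fun y x => (y : ℝ) * x) fun y => by fun_prop

/-- Level sets are disjoint, so the integral is a sum of independent scaled compensated Poisson
variables, and the product of their characteristic functions is the exponential of a sum over
levels. -/
lemma charFun_simpleIntegral {F : SimpleFunc S ℝ} (hF : MemLp F 2 μ) (t : ℝ) :
    charFun (P.map (simpleIntegral (compensated μ N) (levelCombination F))) t
      = Complex.exp (∫ s, charExponent (t * F s) ∂μ) := by
  have hfin : ∀ y ∈ nonzeroRange F, μ (F ⁻¹' {y}) ≠ ∞ := fun y hy =>
    (SimpleFunc.measure_preimage_lt_top_of_memLp (by norm_num) (by norm_num) F hF y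
      (ne_zero_of_mem_nonzeroRange hy)).ne
  have hms : ∀ y : ℝ, MeasurableSet (F ⁻¹' {y}) := fun y => F.measurableSet_preimage _
  have h1 := (hN.iIndepFun_levelSets F).charFun_map_fun_sum_eq_prod
    fun y : nonzeroRange F =>
      ((hN.measurable_compensated (hms y)).const_mul (y : ℝ)).aemeasurable
  rw [simpleIntegral_levelCombination]
  simp only [← Finset.sum_coe_sort (nonzeroRange F)]
  rw [h1, Finset.prod_apply, SimpleFunc.integral_comp_eq_sum
    ((SimpleFunc.memLp_iff_integrable (by norm_num) (by norm_num)).1 hF)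
    (g := fun x => charExponent (t * x)) (by simp [charExponent_zero]),
    ← Finset.sum_coe_sort (nonzeroRange F), Complex.exp_sum]
  refine Finset.prod_congr rfl fun y _ => ?_
  rw [charFun_map_mul_comp (hN.measurable_compensated (hms y)).aemeasurable,
    hN.charFun_compensated (hms y) (hfin y y.2), mul_comm t]

lemma lintegral_exp_simpleIntegral {F : SimpleFunc S ℝ} (hF : MemLp F 2 μ) (t : ℝ) :
    ∫⁻ ω, ENNReal.ofReal (Real.exp
        (t * simpleIntegral (compensated μ N) (levelCombination F) ω)) ∂P
      = ENNReal.ofReal (Real.exp (∫ s, (Real.exp (t * F s) - 1 - t * F s) ∂μ)) := by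
  have hfin : ∀ y ∈ nonzeroRange F, μ (F ⁻¹' {y}) ≠ ∞ := fun y hy =>
    (SimpleFunc.measure_preimage_lt_top_of_memLp (by norm_num) (by norm_num) F hF y
      (ne_zero_of_mem_nonzeroRange hy)).ne
  have hms : ∀ y : ℝ, MeasurableSet (F ⁻¹' {y}) := fun y => F.measurableSet_preimage _
  have hind := hN.iIndepFun_levelSets F
  have hmeas : ∀ y : nonzeroRange F, Measurable
      (fun ω => (y : ℝ) * compensated μ N (F ⁻¹' {(y : ℝ)}) ω) :=
    fun y => (hN.measurable_compensated (hms y)).const_mul (y : ℝ)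
  have hint : ∀ y : nonzeroRange F, Integrable
      (fun ω => Real.exp (t * ((y : ℝ) * compensated μ N (F ⁻¹' {(y : ℝ)}) ω))) P := fun y => by
    simpa only [mul_assoc] using
      hN.integrable_exp_compensated (hms y) (hfin y y.2) (t * y)
  have h1 := hind.mgf_sum hmeas Finset.univ (t := t)
  have h2 := hind.integrable_exp_mul_sum hmeas (s := Finset.univ) (t := t) fun y _ => hint y
  have h3 : simpleIntegral (compensated μ N) (levelCombination F)
      = ∑ y : nonzeroRange F, fun ω => (y : ℝ) * compensated μ N (F ⁻¹' {(y : ℝ)}) ω := by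
    rw [simpleIntegral_levelCombination]
    ext ω
    rw [Finset.sum_apply, ← Finset.sum_coe_sort (nonzeroRange F)]
  rw [h3, ← ofReal_integral_eq_lintegral_ofReal h2 (ae_of_all _ fun ω => (Real.exp_pos _).le)]
  congr 1
  rw [mgf] at h1
  rw [h1, SimpleFunc.integral_comp_eq_sum
    ((SimpleFunc.memLp_iff_integrable (by norm_num) (by norm_num)).1 hF)
    (g := fun x => Real.exp (t * x) - 1 - t * x) (by simp),
    ← Finset.sum_coe_sort (nonzeroRange F), Real.exp_sum]
  refine Finset.prod_congr rfl fun y _ => ?_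
  rw [mgf_const_mul, hN.mgf_compensated (hms y) (hfin y y.2), mul_comm t, smul_eq_mul]

lemma levelCombination_mem {F : SimpleFunc S ℝ} (hF : MemLp F 2 μ) :
    ∀ A ∈ (levelCombination F).support, A ∈ {F | MeasurableSet F ∧ μ F ≠ ∞} := by
  intro A hA
  obtain ⟨y, hy, rfl⟩ := mem_support_levelCombination hA
  exact ⟨F.measurableSet_preimage _,
    (SimpleFunc.measure_preimage_lt_top_of_memLp (by norm_num) (by norm_num) F hF y hy).ne⟩

/-- A measurable function of `L²(μ)` with values in a set containing `0` has an integral, which is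
the almost sure limit of the integrals of simple functions with values in that set. -/
lemma exists_isL2Integral_and_approx {f : S → ℝ} (hfm : Measurable f) (hf : MemLp f 2 μ)
    {s : Set ℝ} (h0 : (0 : ℝ) ∈ s) (hfs : ∀ x, f x ∈ s) :
    ∃ X : Ω → ℝ, IsL2Integral P μ {F | MeasurableSet F ∧ μ F ≠ ∞} (compensated μ N) f X ∧
      ∃ F : ℕ → SimpleFunc S ℝ, (∀ n x, F n x ∈ s) ∧ (∀ n, MemLp (F n) 2 μ) ∧
        (∀ n x, |F n x| ≤ 2 * |f x|) ∧ (∀ x, Tendsto (fun n => F n x) atTop (𝓝 (f x))) ∧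
        ∀ᵐ ω ∂P, Tendsto (fun n => simpleIntegral (compensated μ N) (levelCombination (F n)) ω)
          atTop (𝓝 (X ω)) := by
  -- `approxOn` keeps values in `s`; with `s = [-1, 1]` the approximants inherit the bound needed
  -- for exponential moments.
  let F := SimpleFunc.approxOn f hfm s 0 h0
  have hFm : ∀ n, MemLp (F n) 2 μ := SimpleFunc.memLp_approxOn hfm hf h0 (by simp)
  have hFt : Tendsto (fun n => eLpNorm (fun s => F n s - f s) 2 μ) atTop (𝓝 0) :=
    SimpleFunc.tendsto_approxOn_Lp_eLpNorm hfm h0 (by norm_num)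
      (ae_of_all _ fun x => subset_closure (hfs x)) (by simpa using hf.2)
  have hI := hN.isScaledIsometry_compensated
  have hmem := fun n => hN.levelCombination_mem (hFm n)
  obtain ⟨X, hX, hXt⟩ := hI.exists_tendsto hf (fun n => levelCombination (F n)) hmem
    (by simpa only [simpleFunction_levelCombination] using hFt)
  -- `L²` convergence gives convergence in measure, hence almost sure convergence along a
  -- subsequence, which supplies the approximants returned.
  have hmeas := tendstoInMeasure_of_tendsto_eLpNorm (by norm_num)
    (fun n => (hI.memLp_simpleIntegral (hmem n)).1) hX.1 hXt
  obtain ⟨ns, hns, hae⟩ := hmeas.exists_seq_tendsto_ae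
  refine ⟨X, ⟨hX, fun n => levelCombination (F n), hmem, ?_, hXt⟩, fun n => F (ns n), ?_, ?_, ?_,
    ?_, hae⟩
  · simpa only [simpleFunction_levelCombination] using hFt
  · exact fun n x => SimpleFunc.approxOn_mem hfm h0 _ _
  · exact fun n => hFm _
  · intro n x
    have := SimpleFunc.norm_approxOn_zero_le hfm h0 x (ns n)
    simp only [Real.norm_eq_abs] at this
    rw [two_mul]
    exact this
  · exact fun x => (SimpleFunc.tendsto_approxOn hfm h0 (subset_closure (hfs x))).comp
      hns.tendsto_atTop

lemma exists_isL2Integral {f : S → ℝ} (hf : MemLp f 2 μ) :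
    ∃ X : Ω → ℝ, IsL2Integral P μ {F | MeasurableSet F ∧ μ F ≠ ∞} (compensated μ N) f X := by
  have hm := hf.1.stronglyMeasurable_mk.measurable
  have hf' : MemLp (hf.1.mk f) 2 μ := hf.ae_eq hf.1.ae_eq_mk
  obtain ⟨X, hX, -⟩ := hN.exists_isL2Integral_and_approx hm hf' (mem_univ 0) fun x => mem_univ _
  exact ⟨X, hX.congr hf.1.ae_eq_mk.symm⟩

/-- The characteristic function of an integral with respect to the compensated Poisson random
measure. -/
lemma charFun_isL2Integral {f : S → ℝ} (hfm : Measurable f) (hf : MemLp f 2 μ) {X : Ω → ℝ}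
    (hX : IsL2Integral P μ {F | MeasurableSet F ∧ μ F ≠ ∞} (compensated μ N) f X) (t : ℝ) :
    charFun (P.map X) t = Complex.exp (∫ s, charExponent (t * f s) ∂μ) := by
  obtain ⟨Y, hY, F, -, hFm, hFb, hFt, hFY⟩ :=
    hN.exists_isL2Integral_and_approx hfm hf (mem_univ 0) fun x => mem_univ _
  have hI := hN.isScaledIsometry_compensated
  rw [Measure.map_congr (hI.isL2Integral_ae_unique hf hX hY)]
  have h1 : Tendsto (fun n => charFun
      (P.map (simpleIntegral (compensated μ N) (levelCombination (F n)))) t) atTop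
      (𝓝 (charFun (P.map Y) t)) := by
    have hm : ∀ n, AEStronglyMeasurable
        (simpleIntegral (compensated μ N) (levelCombination (F n))) P :=
      fun n => (hI.memLp_simpleIntegral (hN.levelCombination_mem (hFm n))).1
    simp only [charFun_apply_real]
    rw [integral_map hY.1.1.aemeasurable (by fun_prop)]
    simp_rw [fun n => integral_map (hm n).aemeasurable (f := fun x : ℝ =>
      Complex.exp (t * x * Complex.I)) (by fun_prop)]
    refine tendsto_integral_of_dominated_convergence (fun _ => 1) (fun n => ?_)
      (integrable_const _) (fun n => ae_of_all _ fun ω => ?_) ?_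
    · exact Continuous.comp_aestronglyMeasurable
        (g := fun x : ℝ => Complex.exp (t * x * Complex.I)) (by fun_prop) (hm n)
    · rw [← Complex.ofReal_mul, Complex.norm_exp_ofReal_mul_I]
    · filter_upwards [hFY] with ω hω
      exact ((by fun_prop : Continuous fun x : ℝ =>
        Complex.exp (t * x * Complex.I)).tendsto _).comp hω
  refine tendsto_nhds_unique h1 ?_
  simp_rw [fun n => hN.charFun_simpleIntegral (hFm n) t]
  refine (Complex.continuous_exp.tendsto _).comp ?_
  -- The constant is `12 = 3 · 2²`: the bound on `charExponent` combined with `|F n| ≤ 2 |f|`.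
  refine tendsto_integral_of_dominated_convergence (fun s => 12 * t ^ 2 * f s ^ 2) (fun n => ?_)
    (hf.integrable_sq.const_mul _) (fun n => ae_of_all _ fun s => ?_) (ae_of_all _ fun s => ?_)
  · exact (integrable_charExponent (hFm n) t).1
  · refine (norm_charExponent_le _).trans ?_
    have h2 : F n s ^ 2 ≤ (2 * |f s|) ^ 2 := by
      rw [← sq_abs (F n s)]
      exact pow_le_pow_left₀ (abs_nonneg _) (hFb n s) 2
    rw [mul_pow, sq_abs] at h2
    nlinarith [mul_le_mul_of_nonneg_left h2 (sq_nonneg t)]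
  · exact (continuous_charExponent.tendsto _).comp ((hFt s).const_mul t)

/-- Integrals of functions with values in `[-1, 1]` have exponential moments. -/
lemma lintegral_exp_isL2Integral_lt_top {f : S → ℝ} (hfm : Measurable f) (hf : MemLp f 2 μ)
    (hf1 : ∀ x, |f x| ≤ 1) {X : Ω → ℝ}
    (hX : IsL2Integral P μ {F | MeasurableSet F ∧ μ F ≠ ∞} (compensated μ N) f X)
    {t : ℝ} (ht : |t| ≤ 1) :
    ∫⁻ ω, ENNReal.ofReal (Real.exp (t * X ω)) ∂P < ∞ := by
  obtain ⟨Y, hY, F, hFs, hFm, hFb, hFt, hFY⟩ :=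
    hN.exists_isL2Integral_and_approx hfm hf (s := Icc (-1) 1) (by simp)
      fun x => abs_le.1 (hf1 x)
  have hI := hN.isScaledIsometry_compensated
  have hXY : ∫⁻ ω, ENNReal.ofReal (Real.exp (t * X ω)) ∂P
      = ∫⁻ ω, ENNReal.ofReal (Real.exp (t * Y ω)) ∂P := by
    refine lintegral_congr_ae ?_
    filter_upwards [hI.isL2Integral_ae_unique hf hX hY] with ω hω
    rw [hω]
  have hae : ∀ᵐ ω ∂P, ENNReal.ofReal (Real.exp (t * Y ω))
      = liminf (fun n => ENNReal.ofReal (Real.exp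
        (t * simpleIntegral (compensated μ N) (levelCombination (F n)) ω))) atTop := by
    filter_upwards [hFY] with ω hω
    refine (Tendsto.liminf_eq ?_).symm
    exact ENNReal.tendsto_ofReal ((Real.continuous_exp.tendsto _).comp (hω.const_mul t))
  rw [hXY, lintegral_congr_ae hae]
  refine (lintegral_liminf_le' fun n => ?_).trans_lt ?_
  · have := (hI.memLp_simpleIntegral (hN.levelCombination_mem (hFm n))).1.aemeasurable
    fun_prop
  -- After Fatou, a bound uniform in `n` is needed. It comes from `e^x - 1 - x ≤ x²` at `x = t F n`,
  -- where `|x| ≤ 1` and `x² ≤ 4 f²`.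
  · refine lt_of_le_of_lt (liminf_le_of_le (a := ENNReal.ofReal (Real.exp (∫ s, 4 * f s ^ 2 ∂μ)))
      (by isBoundedDefault) fun b hb => ?_) ENNReal.ofReal_lt_top
    obtain ⟨n, hn⟩ := hb.exists
    refine hn.trans ?_
    rw [hN.lintegral_exp_simpleIntegral (hFm n)]
    refine ENNReal.ofReal_le_ofReal (Real.exp_le_exp.2 (integral_mono_of_nonneg
      (ae_of_all _ fun s => ?_) (hf.integrable_sq.const_mul 4) (ae_of_all _ fun s => ?_)))
    · have := Real.add_one_le_exp (t * F n s)
      simp only [Pi.zero_apply]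
      linarith
    · have h1 : |t * F n s| ≤ 1 := by
        rw [abs_mul]
        exact mul_le_one₀ ht (abs_nonneg _) (abs_le.2 (hFs n s))
      have h2 := (abs_le.1 (Real.abs_exp_sub_one_sub_id_le h1)).2
      have h3 : F n s ^ 2 ≤ (2 * |f s|) ^ 2 := by
        rw [← sq_abs (F n s)]
        exact pow_le_pow_left₀ (abs_nonneg _) (hFb n s) 2
      rw [mul_pow, sq_abs] at h3
      have h4 : t ^ 2 ≤ 1 := by rw [← sq_abs]; exact pow_le_one₀ (abs_nonneg _) ht
      simp only
      nlinarith [mul_le_mul_of_nonneg_right h4 (sq_nonneg (F n s))]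

end IsPoissonRandomMeasure

end Law

/-! ### Compound Poisson laws and submultiplicative weights. -/

section CompoundPoisson

/-- Convolution powers of a measure on the line. -/
def convPow (ρ : Measure ℝ) : ℕ → Measure ℝ
  | 0 => Measure.dirac 0
  | n + 1 => (convPow ρ n).conv ρ

/-- The compound Poisson distribution with jump measure `ρ`. -/
def compoundPoisson (ρ : Measure ℝ) : Measure ℝ :=
  Measure.sum fun n : ℕ =>
    ENNReal.ofReal (Real.exp (-ρ.real univ) / n.factorial) • convPow ρ n

variable {ρ : Measure ℝ}

lemma lintegral_conv_le_mul {μ ν : Measure ℝ} [SFinite ν] {h : ℝ → ℝ≥0∞} (hm : Measurable h)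
    (hmul : ∀ x y, h (x + y) ≤ h x * h y) :
    ∫⁻ x, h x ∂(μ.conv ν) ≤ (∫⁻ x, h x ∂μ) * ∫⁻ x, h x ∂ν := by
  rw [Measure.lintegral_conv hm, ← lintegral_mul_const _ hm]
  refine lintegral_mono fun x => ?_
  rw [← lintegral_const_mul _ hm]
  exact lintegral_mono fun y => hmul x y

variable [IsFiniteMeasure ρ]

instance isFiniteMeasure_convPow (n : ℕ) : IsFiniteMeasure (convPow ρ n) := by
  induction n with
  | zero => exact inferInstanceAs (IsFiniteMeasure (Measure.dirac (0 : ℝ)))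
  | succ n ih => exact inferInstanceAs (IsFiniteMeasure ((convPow ρ n).conv ρ))

lemma lintegral_convPow_le {h : ℝ → ℝ≥0∞} (hm : Measurable h) (h0 : h 0 ≤ 1)
    (hmul : ∀ x y, h (x + y) ≤ h x * h y) (n : ℕ) :
    ∫⁻ x, h x ∂(convPow ρ n) ≤ (∫⁻ x, h x ∂ρ) ^ n := by
  induction n with
  | zero => simpa [convPow] using h0
  | succ n ih =>
    rw [pow_succ]
    exact (lintegral_conv_le_mul hm hmul).trans (mul_le_mul_left ih _)

/-- With `c = ∫ h dρ`, the `n`-th convolution power integrates `h` to at most `c^n`, so the series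
is dominated by that of `e^c`. -/
lemma lintegral_compoundPoisson_lt_top {h : ℝ → ℝ≥0∞} (hm : Measurable h) (h0 : h 0 ≤ 1)
    (hmul : ∀ x y, h (x + y) ≤ h x * h y) (hρ : ∫⁻ x, h x ∂ρ < ∞) :
    ∫⁻ x, h x ∂(compoundPoisson ρ) < ∞ := by
  set c := (∫⁻ x, h x ∂ρ).toReal with hc
  have hc' : ∫⁻ x, h x ∂ρ = ENNReal.ofReal c := (ENNReal.ofReal_toReal hρ.ne).symm
  have hc0 : 0 ≤ c := ENNReal.toReal_nonneg
  rw [compoundPoisson, lintegral_sum_measure]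
  refine lt_of_le_of_lt (ENNReal.tsum_le_tsum (g := fun n : ℕ => ENNReal.ofReal
    (Real.exp (-ρ.real univ) * (c ^ n / n.factorial))) fun n => ?_) ?_
  · rw [lintegral_smul_measure, smul_eq_mul]
    refine (mul_le_mul_right (lintegral_convPow_le hm h0 hmul n) _).trans (le_of_eq ?_)
    rw [hc', ← ENNReal.ofReal_pow hc0, ← ENNReal.ofReal_mul (by positivity)]
    congr 1
    ring
  · rw [← ENNReal.ofReal_tsum_of_nonneg (fun n => by positivity)
      ((Real.summable_pow_div_factorial c).mul_left _)]
    exact ENNReal.ofReal_lt_top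

instance isFiniteMeasure_compoundPoisson : IsFiniteMeasure (compoundPoisson ρ) := by
  refine ⟨?_⟩
  rw [← lintegral_one]
  exact lintegral_compoundPoisson_lt_top measurable_const le_rfl (fun _ _ => by simp) (by simp)

lemma charFun_convPow (n : ℕ) (t : ℝ) : charFun (convPow ρ n) t = charFun ρ t ^ n := by
  induction n with
  | zero => simp [convPow]
  | succ n ih => rw [convPow, charFun_conv, ih, pow_succ]

lemma charFun_compoundPoisson (t : ℝ) :
    charFun (compoundPoisson ρ) t = Complex.exp (charFun ρ t - ρ.real univ) := by
  have hint : Integrable (fun x : ℝ => Complex.exp (t * x * Complex.I)) (compoundPoisson ρ) := by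
    refine Integrable.mono' (integrable_const (1 : ℝ)) (by fun_prop) (ae_of_all _ fun x => ?_)
    rw [← Complex.ofReal_mul, Complex.norm_exp_ofReal_mul_I]
  have h1 := hasSum_integral_measure hint
  have h2 := (NormedSpace.expSeries_div_hasSum_exp (charFun ρ t)).mul_left
    (Complex.exp (-ρ.real univ))
  rw [← Complex.exp_eq_exp_ℂ, ← Complex.exp_add, add_comm, ← sub_eq_add_neg] at h2
  rw [charFun_apply_real]
  refine h1.unique (h2.congr_fun fun n => ?_)
  rw [integral_smul_measure, ← charFun_apply_real, charFun_convPow,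
    ENNReal.toReal_ofReal (by positivity), Complex.real_smul]
  push_cast
  ring

/-- Keep only the term of exactly one jump, `n = 1`. -/
lemma lintegral_le_compoundPoisson (h : ℝ → ℝ≥0∞) :
    ENNReal.ofReal (Real.exp (-ρ.real univ)) * ∫⁻ x, h x ∂ρ ≤ ∫⁻ x, h x ∂(compoundPoisson ρ) := by
  rw [compoundPoisson, lintegral_sum_measure]
  refine le_trans (le_of_eq ?_) (ENNReal.le_tsum 1)
  rw [lintegral_smul_measure]
  simp [convPow, Measure.dirac_zero_conv]

end CompoundPoisson

/-! ### Splitting off the large jumps; moment criteria. -/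

section Decomposition

variable {Ω S : Type*} [MeasurableSpace Ω] [MeasurableSpace S] {P : Measure Ω}
  [IsProbabilityMeasure P] {μ : Measure S} {N : Ω → Measure S} {f : S → ℝ} {X Y : Ω → ℝ}

lemma measure_one_lt_abs_lt_top (hf : MemLp f 2 μ) : μ {s | 1 < |f s|} < ∞ := by
  refine lt_of_le_of_lt (measure_mono fun s hs => ?_)
    (hf.meas_ge_lt_top (by norm_num) (by norm_num) (ε := 1) (by norm_num))
  simp only [mem_ofPred_eq] at hs ⊢
  rw [← NNReal.coe_le_coe]
  simpa using hs.le

/-- The jump measure of the large jumps of `f`. -/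
def largeJumps (μ : Measure S) (f : S → ℝ) : Measure ℝ := (μ.restrict {s | 1 < |f s|}).map f

lemma isFiniteMeasure_largeJumps (hf : MemLp f 2 μ) : IsFiniteMeasure (largeJumps μ f) := by
  have : IsFiniteMeasure (μ.restrict {s | 1 < |f s|}) :=
    ⟨by simpa using measure_one_lt_abs_lt_top hf⟩
  unfold largeJumps
  infer_instance

/-- An integral is the sum of an independent integral with small jumps and a compensated compound
Poisson variable. -/
lemma IsPoissonRandomMeasure.map_isL2Integral_eq_conv (hN : IsPoissonRandomMeasure P μ N)
    (hfm : Measurable f) (hf : MemLp f 2 μ)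
    (hX : IsL2Integral P μ {F | MeasurableSet F ∧ μ F ≠ ∞} (compensated μ N) f X)
    (hY : IsL2Integral P μ {F | MeasurableSet F ∧ μ F ≠ ∞} (compensated μ N)
      ({s | 1 < |f s|}ᶜ.indicator f) Y) :
    P.map X = (P.map Y).conv ((compoundPoisson (largeJumps μ f)).conv
      (Measure.dirac (-∫ s in {s | 1 < |f s|}, f s ∂μ))) := by
  have hD : MeasurableSet {s | 1 < |f s|} := measurableSet_lt measurable_const hfm.norm
  set D := {s | 1 < |f s|} with hDdef
  have : IsFiniteMeasure (μ.restrict D) := ⟨by simpa using measure_one_lt_abs_lt_top hf⟩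
  have := isFiniteMeasure_largeJumps hf
  have := Measure.isProbabilityMeasure_map hX.1.1.aemeasurable
  have := Measure.isProbabilityMeasure_map hY.1.1.aemeasurable
  have hfD : Integrable f (μ.restrict D) := (hf.restrict D).integrable (by norm_num)
  -- Finite measures on the line are determined by their characteristic functions, so comparing
  -- exponents suffices and no joint law is needed.
  refine Measure.ext_of_charFun ?_
  ext t
  rw [charFun_conv, charFun_conv, hN.charFun_isL2Integral hfm hf hX,
    hN.charFun_isL2Integral (hfm.indicator hD.compl) (hf.indicator hD.compl) hY,
    charFun_compoundPoisson, charFun_dirac, ← Complex.exp_add, ← Complex.exp_add]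
  congr 1
  have h1 : (∫ s, charExponent (t * Dᶜ.indicator f s) ∂μ)
      = ∫ s in Dᶜ, charExponent (t * f s) ∂μ := by
    rw [← integral_indicator hD.compl]
    refine integral_congr_ae (ae_of_all _ fun s => ?_)
    by_cases hs : s ∈ Dᶜ
    · simp [hs]
    · simp [indicator_of_notMem hs, charExponent_zero]
  have h2 : charFun (largeJumps μ f) t
      = ∫ s in D, Complex.exp ((t * f s : ℝ) * Complex.I) ∂μ := by
    rw [charFun_apply_real, largeJumps, integral_map hfm.aemeasurable (by fun_prop)]
    simp [hDdef]
  have h3 : (largeJumps μ f).real univ = μ.real D := by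
    rw [largeJumps, measureReal_def, Measure.map_apply hfm MeasurableSet.univ]
    simp [measureReal_def, hDdef]
  have i1 : Integrable (fun s => Complex.exp ((t * f s : ℝ) * Complex.I)) (μ.restrict D) := by
    refine Integrable.mono' (integrable_const (1 : ℝ)) (by fun_prop) (ae_of_all _ fun x => ?_)
    rw [Complex.norm_exp_ofReal_mul_I]
  have i2 : Integrable (fun s => ((t * f s : ℝ) : ℂ) * Complex.I) (μ.restrict D) :=
    ((hfD.const_mul t).ofReal).mul_const _
  -- On `D`, of finite measure, each term is integrable separately: `e^{itf} - 1` gives the compound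
  -- Poisson exponent and `-itf` the point mass.
  have h4 : ∫ s in D, charExponent (t * f s) ∂μ
      = (∫ s in D, Complex.exp ((t * f s : ℝ) * Complex.I) ∂μ) - μ.real D
        - (t * ∫ s in D, f s ∂μ : ℝ) * Complex.I := by
    simp only [charExponent]
    have i3 : Integrable (fun s => Complex.exp ((t * f s : ℝ) * Complex.I) - 1) (μ.restrict D) :=
      i1.sub (integrable_const _)
    rw [integral_sub i3 i2, integral_sub i1 (integrable_const _),
      integral_mul_const, integral_complex_ofReal, integral_const_mul]
    simp
  rw [← integral_add_compl hD (integrable_charExponent hf t), h1, h2, h3, h4]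
  simp only [Real.inner_apply]
  push_cast
  ring

/-- Integrability of `g(X)` for submultiplicative `g` forces that of `g(f)` on `{|f| > 1}`. -/
lemma IsPoissonRandomMeasure.setLIntegral_lt_top (hN : IsPoissonRandomMeasure P μ N)
    (hfm : Measurable f) (hf : MemLp f 2 μ)
    (hX : IsL2Integral P μ {F | MeasurableSet F ∧ μ F ≠ ∞} (compensated μ N) f X)
    {g : ℝ → ℝ} (hg : Measurable g) (hg0 : ∀ x, 0 ≤ g x) (hsub : IsSubmultiplicative g)
    (hgX : ∫⁻ ω, ENNReal.ofReal (g (X ω)) ∂P < ∞) :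
    ∫⁻ s in {s | 1 < |f s|}, ENNReal.ofReal (g (f s)) ∂μ < ∞ := by
  have hD : MeasurableSet {s | 1 < |f s|} := measurableSet_lt measurable_const hfm.norm
  obtain ⟨a, ha, hag⟩ := hsub
  obtain ⟨Y, hY⟩ := hN.exists_isL2Integral (hf.indicator hD.compl)
  have hmap := hN.map_isL2Integral_eq_conv hfm hf hX hY
  set c := ∫ s in {s | 1 < |f s|}, f s ∂μ
  have := isFiniteMeasure_largeJumps hf
  have := Measure.isProbabilityMeasure_map hY.1.1.aemeasurable
  have hGm : Measurable fun x => ENNReal.ofReal (g x) := hg.ennreal_ofReal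
  have h1 : ∫⁻ x, ∫⁻ y, ENNReal.ofReal (g (x + (y + -c))) ∂(compoundPoisson (largeJumps μ f))
      ∂(P.map Y) < ∞ := by
    rw [← lintegral_map' (f := fun x => ENNReal.ofReal (g x)) hGm.aemeasurable
      hX.1.1.aemeasurable, hmap, Measure.lintegral_conv hGm] at hgX
    refine lt_of_le_of_lt (le_of_eq (lintegral_congr fun x => ?_)) hgX
    rw [Measure.lintegral_conv (by fun_prop)]
    refine lintegral_congr fun y => ?_
    rw [lintegral_dirac' _ (by fun_prop)]
  have h2 : Measurable fun x => ∫⁻ y, ENNReal.ofReal (g (x + (y + -c)))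
      ∂(compoundPoisson (largeJumps μ f)) :=
    Measurable.lintegral_prod_right' (f := fun q : ℝ × ℝ => ENNReal.ofReal (g (q.1 + (q.2 + -c))))
      (by fun_prop)
  -- By Tonelli the inner integral is finite for almost every value of `Y`; a single value `x` is
  -- enough.
  obtain ⟨x, hx⟩ := (ae_lt_top h2 h1.ne).exists
  have h3 : ∫⁻ y, ENNReal.ofReal (g y) ∂(compoundPoisson (largeJumps μ f)) < ∞ := by
    refine lt_of_le_of_lt (lintegral_mono (g := fun y => ENNReal.ofReal (a * g (c - x))
      * ENNReal.ofReal (g (x + (y + -c)))) fun y => ?_) ?_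
    · simp only
      rw [← ENNReal.ofReal_mul (mul_nonneg ha.le (hg0 _))]
      refine ENNReal.ofReal_le_ofReal ?_
      -- Writing `y = (c - x) + (x + y - c)` undoes the translation at the cost of the constant `a
      -- g(c - x)`.
      have := hag (c - x) (x + (y + -c))
      rwa [show c - x + (x + (y + -c)) = y by ring] at this
    · rw [lintegral_const_mul _ (by fun_prop)]
      exact ENNReal.mul_lt_top ENNReal.ofReal_lt_top hx
  have h4 := (lintegral_le_compoundPoisson (ρ := largeJumps μ f)
    fun y => ENNReal.ofReal (g y)).trans_lt h3
  have h5 : ∫⁻ y, ENNReal.ofReal (g y) ∂(largeJumps μ f) < ∞ := by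
    by_contra hne
    rw [not_lt_top_iff.1 hne, ENNReal.mul_top (by simp [Real.exp_pos])] at h4
    exact lt_irrefl _ h4
  rwa [largeJumps, lintegral_map hGm hfm] at h5

/-- For `p > 0` the function `|x|^p` vanishes at `0` and is not submultiplicative; this weight
replaces it and equals `1` at `0`. -/
lemma one_add_abs_rpow_add_le {p : ℝ} (hp : 0 ≤ p) (x y : ℝ) :
    (1 + |x + y|) ^ p ≤ (1 + |x|) ^ p * (1 + |y|) ^ p := by
  rw [← Real.mul_rpow (by positivity) (by positivity)]
  refine Real.rpow_le_rpow (by positivity) ?_ hp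
  nlinarith [abs_add_le x y, mul_nonneg (abs_nonneg x) (abs_nonneg y)]

/-- Raise `1 + |x| ≤ p + |x| ≤ p e^{|x|/p}` to the power `p`. -/
lemma one_add_abs_rpow_le_exp {p : ℝ} (hp : 1 ≤ p) (x : ℝ) :
    (1 + |x|) ^ p ≤ p ^ p * (Real.exp (1 * x) + Real.exp (-1 * x)) := by
  have hp0 : 0 < p := by linarith
  have h1 : 1 + |x| ≤ p * Real.exp (|x| / p) := by
    have := mul_le_mul_of_nonneg_left (Real.add_one_le_exp (|x| / p)) hp0.le
    rw [mul_add, mul_div_cancel₀ _ hp0.ne'] at this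
    linarith
  refine (Real.rpow_le_rpow (by positivity) h1 hp0.le).trans ?_
  rw [Real.mul_rpow hp0.le (Real.exp_pos _).le, ← Real.exp_mul, div_mul_cancel₀ _ hp0.ne']
  gcongr
  rcases abs_cases x with ⟨h, -⟩ | ⟨h, -⟩ <;> rw [h]
  · have := Real.exp_pos (-1 * x)
    rw [one_mul]; linarith
  · have := Real.exp_pos (1 * x)
    rw [neg_one_mul]; linarith

/-- Finiteness of the `p`-th moment of an integral of a function of `L²(μ) ∩ L^p(μ)`. -/
lemma IsPoissonRandomMeasure.lintegral_rpow_lt_top (hN : IsPoissonRandomMeasure P μ N)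
    (hfm : Measurable f) (hf : MemLp f 2 μ)
    (hX : IsL2Integral P μ {F | MeasurableSet F ∧ μ F ≠ ∞} (compensated μ N) f X)
    {p : ℝ} (hp : 2 ≤ p) (hfp : ∫⁻ s, ENNReal.ofReal (|f s| ^ p) ∂μ < ∞) :
    ∫⁻ ω, ENNReal.ofReal ((1 + |X ω|) ^ p) ∂P < ∞ := by
  have hp0 : 0 ≤ p := by linarith
  have hD : MeasurableSet {s | 1 < |f s|} := measurableSet_lt measurable_const hfm.norm
  obtain ⟨Y, hY⟩ := hN.exists_isL2Integral (hf.indicator hD.compl)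
  have hmap := hN.map_isL2Integral_eq_conv hfm hf hX hY
  set c := ∫ s in {s | 1 < |f s|}, f s ∂μ
  have := isFiniteMeasure_largeJumps hf
  set h : ℝ → ℝ≥0∞ := fun x => ENNReal.ofReal ((1 + |x|) ^ p) with hh
  have hm : Measurable h := by fun_prop
  have hmul : ∀ x y, h (x + y) ≤ h x * h y := fun x y => by
    simp only [hh]
    rw [← ENNReal.ofReal_mul (by positivity)]
    exact ENNReal.ofReal_le_ofReal (one_add_abs_rpow_add_le hp0 x y)
  rw [← lintegral_map' (f := h) hm.aemeasurable hX.1.1.aemeasurable, hmap]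
  refine (lintegral_conv_le_mul hm hmul).trans_lt (ENNReal.mul_lt_top ?_
    ((lintegral_conv_le_mul hm hmul).trans_lt (ENNReal.mul_lt_top ?_ ?_)))
  -- Small jumps: the weight is controlled by the exponential moments at `t = 1` and `t = -1`.
  · rw [lintegral_map' hm.aemeasurable hY.1.1.aemeasurable]
    have hb : ∀ s, |{s | 1 < |f s|}ᶜ.indicator f s| ≤ 1 := fun s => by
      by_cases hs : s ∈ {s | 1 < |f s|}ᶜ
      · rw [indicator_of_mem hs]; exact not_lt.1 hs
      · rw [indicator_of_notMem hs]; simp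
    have e1 := hN.lintegral_exp_isL2Integral_lt_top (hfm.indicator hD.compl)
      (hf.indicator hD.compl) hb hY (t := 1) (by simp)
    have e2 := hN.lintegral_exp_isL2Integral_lt_top (hfm.indicator hD.compl)
      (hf.indicator hD.compl) hb hY (t := -1) (by simp)
    have hYm := hY.1.1.aemeasurable
    refine lt_of_le_of_lt (lintegral_mono (g := fun ω => ENNReal.ofReal (p ^ p)
      * (ENNReal.ofReal (Real.exp (1 * Y ω)) + ENNReal.ofReal (Real.exp (-1 * Y ω))))
      fun ω => ?_) ?_
    · simp only
      rw [← ENNReal.ofReal_add (Real.exp_pos _).le (Real.exp_pos _).le,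
        ← ENNReal.ofReal_mul (by positivity)]
      exact ENNReal.ofReal_le_ofReal (one_add_abs_rpow_le_exp (by linarith) _)
    · rw [lintegral_const_mul'' _ (by fun_prop), lintegral_add_left' (by fun_prop)]
      exact ENNReal.mul_lt_top ENNReal.ofReal_lt_top (ENNReal.add_lt_top.2 ⟨e1, e2⟩)
  · refine lintegral_compoundPoisson_lt_top hm (by simp [hh]) hmul ?_
    rw [largeJumps, lintegral_map hm hfm]
    -- Large jumps: where `|f| > 1`, one has `1 + |f| ≤ 2 |f|`.
    refine lt_of_le_of_lt (setLIntegral_mono' (g := fun s => ENNReal.ofReal (2 ^ p)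
      * ENNReal.ofReal (|f s| ^ p)) hD fun s hs => ?_) ?_
    · simp only [hh]
      rw [← ENNReal.ofReal_mul (by positivity), ← Real.mul_rpow (by norm_num) (abs_nonneg _)]
      refine ENNReal.ofReal_le_ofReal (Real.rpow_le_rpow (by positivity) ?_ hp0)
      have : 1 < |f s| := hs
      linarith
    · rw [lintegral_const_mul _ (by fun_prop)]
      exact ENNReal.mul_lt_top ENNReal.ofReal_lt_top
        ((lintegral_mono' Measure.restrict_le_self le_rfl).trans_lt hfp)
  · rw [lintegral_dirac' _ hm]
    exact ENNReal.ofReal_lt_top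

end Decomposition

/-! ### Product intensity and density of simple functions over bounded Borel sets. -/

section LevyMeasure

/-- The measure `(|z|² ∧ 1) ν` is finite and its density is positive `ν`-almost everywhere because
`ν {0} = 0`; dividing by the density recovers `ν`. Tonelli for the intensity rests on this. -/
lemma IsLevyMeasure.sFinite {ν : Measure ℝ} (hν : IsLevyMeasure ν) : SFinite ν := by
  have hm : Measurable fun z : ℝ => ENNReal.ofReal (min (|z| ^ 2) 1) := by fun_prop
  have hne : ∀ᵐ z ∂ν, z ≠ 0 := measure_eq_zero_iff_ae_notMem.1 hν.zero
  have := isFiniteMeasure_withDensity hν.lintegral_min_lt_top.ne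
  rw [← withDensity_inv_same (μ := ν) hm ?_ (ae_of_all _ fun z => ENNReal.ofReal_ne_top)]
  · infer_instance
  · filter_upwards [hne] with z hz
    have : 0 < |z| := abs_pos.2 hz
    simp only [ne_eq, ENNReal.ofReal_eq_zero, not_le]
    positivity

variable {d : ℕ} {ν : Measure ℝ}

lemma lintegral_intensity_rpow [SFinite ν] {φ : SpaceTime d → ℝ} (hφ : AEMeasurable φ (leb d))
    {p : ℝ} (hp : 0 ≤ p) :
    ∫⁻ q, ‖q.2 * φ q.1‖ₑ ^ p ∂(intensity d ν) = (∫⁻ s, ‖φ s‖ₑ ^ p ∂(leb d)) * absMoment ν p := by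
  rw [absMoment, intensity, ← lintegral_prod_mul (by fun_prop) (by fun_prop)]
  refine lintegral_congr fun q => ?_
  rw [enorm_mul, ENNReal.mul_rpow_of_nonneg _ _ hp, mul_comm, Real.enorm_eq_ofReal_abs q.2,
    ENNReal.ofReal_rpow_of_nonneg (abs_nonneg _) hp]

lemma eLpNorm_intensity [SFinite ν] {φ : SpaceTime d → ℝ} (hφ : AEMeasurable φ (leb d)) :
    eLpNorm (fun q => q.2 * φ q.1) 2 (intensity d ν)
      = absMoment ν 2 ^ (2⁻¹ : ℝ) * eLpNorm φ 2 (leb d) := by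
  rw [eLpNorm_eq_lintegral_rpow_enorm_toReal (by norm_num) (by norm_num),
    eLpNorm_eq_lintegral_rpow_enorm_toReal (by norm_num) (by norm_num)]
  simp only [ENNReal.toReal_ofNat]
  rw [lintegral_intensity_rpow hφ (by norm_num), ENNReal.mul_rpow_of_nonneg _ _ (by norm_num),
    mul_comm, one_div]

lemma aestronglyMeasurable_intensity [SFinite ν] {φ : SpaceTime d → ℝ}
    (hφ : AEStronglyMeasurable φ (leb d)) :
    AEStronglyMeasurable (fun q : SpaceTime d × ℝ => q.2 * φ q.1) (intensity d ν) :=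
  AEStronglyMeasurable.mul (by fun_prop)
    (hφ.comp_quasiMeasurePreserving Measure.quasiMeasurePreserving_fst)

lemma memLp_intensity [SFinite ν] (hν2 : absMoment ν 2 < ∞) {φ : SpaceTime d → ℝ}
    (hφ : MemLp φ 2 (leb d)) :
    MemLp (fun q : SpaceTime d × ℝ => q.2 * φ q.1) 2 (intensity d ν) := by
  refine ⟨aestronglyMeasurable_intensity hφ.1, ?_⟩
  rw [eLpNorm_intensity hφ.1.aemeasurable]
  exact ENNReal.mul_lt_top (ENNReal.rpow_lt_top_of_nonneg (by norm_num) hν2.ne) hφ.2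

/-- The bounded Borel subsets of `ℝ₊ × ℝ^d`. -/
def boundedBorel (d : ℕ) : Set (Set (SpaceTime d)) :=
  {A | MeasurableSet A ∧ Bornology.IsBounded A ∧ A ⊆ halfSpace d}

lemma measurableSet_halfSpace (d : ℕ) : MeasurableSet (halfSpace d) :=
  measurableSet_Ici.prod MeasurableSet.univ

lemma leb_ne_top_of_mem_boundedBorel {A : Set (SpaceTime d)} (hA : A ∈ boundedBorel d) :
    leb d A ≠ ∞ :=
  ((Measure.restrict_apply_le _ _).trans_lt hA.2.1.measure_lt_top).ne

/-- Dominated convergence in `L²`. -/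
lemma tendsto_eLpNorm_of_dominated {α : Type*} [MeasurableSpace α] {m : Measure α}
    {u : ℕ → α → ℝ} {v : α → ℝ} (hv : MemLp v 2 m) (hu : ∀ n, AEStronglyMeasurable (u n) m)
    (hb : ∀ n x, ‖u n x‖ ≤ 2 * ‖v x‖)
    (ht : ∀ᵐ x ∂m, Tendsto (fun n => u n x) atTop (𝓝 (v x))) :
    Tendsto (fun n => eLpNorm (fun x => u n x - v x) 2 m) atTop (𝓝 0) := by
  simp_rw [eLpNorm_eq_lintegral_rpow_enorm_toReal (two_ne_zero' ℝ≥0∞) ENNReal.ofNat_ne_top]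
  have hvm := hv.1
  have h0 : Tendsto (fun n => ∫⁻ x, ‖u n x - v x‖ₑ ^ (2 : ℝ≥0∞).toReal ∂m) atTop
      (𝓝 (∫⁻ _, 0 ∂m)) := by
    refine tendsto_lintegral_of_dominated_convergence'
      (fun x => ‖3 * v x‖ₑ ^ (2 : ℝ≥0∞).toReal) (fun n => ?_)
      (fun n => ae_of_all _ fun x => ?_) ?_ ?_
    · have := hu n
      fun_prop
    · refine ENNReal.rpow_le_rpow (enorm_le_iff_norm_le.2 ?_) (by norm_num)
      have h1 := norm_sub_le (u n x) (v x)
      have h2 := hb n x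
      rw [norm_mul, Real.norm_ofNat]
      linarith
    · exact (lintegral_rpow_enorm_lt_top_of_eLpNorm_lt_top (two_ne_zero' ℝ≥0∞)
        ENNReal.ofNat_ne_top (hv.const_mul 3).2).ne
    · filter_upwards [ht] with x hx
      have h1 := (hx.sub_const (v x)).enorm.ennrpow_const (2 : ℝ≥0∞).toReal
      simpa using h1
  have h3 := h0.ennrpow_const (1 / (2 : ℝ≥0∞).toReal)
  simpa using h3

/-- Simple functions over bounded Borel sets are dense in `L²(ℝ₊ × ℝ^d)`. -/
lemma exists_tendsto_boundedBorel {φ : SpaceTime d → ℝ} (hφ : MemLp φ 2 (leb d)) :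
    ∃ g : ℕ → (Set (SpaceTime d) →₀ ℝ), (∀ n, ∀ A ∈ (g n).support, A ∈ boundedBorel d) ∧
      Tendsto (fun n => eLpNorm (fun s => simpleFunction (g n) s - φ s) 2 (leb d)) atTop
        (𝓝 0) := by
  wlog hm : Measurable φ generalizing φ
  · obtain ⟨g, hg, hgt⟩ := this (hφ.ae_eq hφ.1.ae_eq_mk) hφ.1.stronglyMeasurable_mk.measurable
    refine ⟨g, hg, hgt.congr fun n => eLpNorm_congr_ae ?_⟩
    filter_upwards [hφ.1.ae_eq_mk] with s hs
    rw [hs]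
  set F := SimpleFunc.approxOn φ hm univ 0 (mem_univ 0)
  -- Cutting off at radius `n` makes the non-zero level sets bounded, and each point of the half
  -- space is eventually kept.
  set B : ℕ → Set (SpaceTime d) := fun n => Metric.closedBall 0 n ∩ halfSpace d
  have hB : ∀ n, MeasurableSet (B n) := fun n =>
    measurableSet_closedBall.inter (measurableSet_halfSpace d)
  refine ⟨fun n => levelCombination ((F n).restrict (B n)), fun n A hA => ?_, ?_⟩
  · obtain ⟨y, hy, rfl⟩ := mem_support_levelCombination hA
    refine ⟨SimpleFunc.measurableSet_preimage _ _, ?_⟩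
    rw [SimpleFunc.restrict_preimage _ (hB n) (fun h => hy h.symm)]
    exact ⟨Metric.isBounded_closedBall.subset (inter_subset_left.trans inter_subset_left),
      inter_subset_left.trans inter_subset_right⟩
  · simp only [simpleFunction_levelCombination]
    refine tendsto_eLpNorm_of_dominated hφ
      (fun n => ((F n).restrict (B n)).measurable.aestronglyMeasurable) (fun n x => ?_) ?_
    · rw [SimpleFunc.restrict_apply _ (hB n)]
      refine (norm_indicator_le_norm_self (F n) x).trans ?_
      rw [two_mul]
      exact SimpleFunc.norm_approxOn_zero_le hm (mem_univ 0) x n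
    · filter_upwards [ae_restrict_mem (measurableSet_halfSpace d)] with x hx
      refine (SimpleFunc.tendsto_approxOn hm (mem_univ 0) (by simp)).congr' ?_
      obtain ⟨k, hk⟩ := exists_nat_ge ‖x‖
      filter_upwards [eventually_ge_atTop k] with n hn
      have hxB : x ∈ B n :=
        ⟨mem_closedBall_zero_iff.2 (hk.trans (Nat.cast_le.2 hn)), hx⟩
      rw [SimpleFunc.restrict_apply _ (hB n), indicator_of_mem hxB]

end LevyMeasure

/-! ### The Lévy integral as a compensated Poisson integral. -/

section LevyNoise

variable {Ω : Type*} [MeasurableSpace Ω] {P : Measure Ω} [IsProbabilityMeasure P] {d : ℕ}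
  {ν : Measure ℝ} {N : Ω → Measure (SpaceTime d × ℝ)}

lemma isL2Integral_levyNoise [SFinite ν] (hν2 : absMoment ν 2 < ∞)
    (hN : IsPoissonRandomMeasure P (intensity d ν) N) {A : Set (SpaceTime d)}
    (hA : A ∈ boundedBorel d) :
    IsL2Integral P (intensity d ν) {F | MeasurableSet F ∧ intensity d ν F ≠ ∞}
      (compensated (intensity d ν) N) (fun q => q.2 * A.indicator (fun _ => (1 : ℝ)) q.1)
      (levyNoise P ν N A) := by
  have h : (fun q : SpaceTime d × ℝ => q.2 * A.indicator (fun _ => (1 : ℝ)) q.1)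
      = fun q => A.indicator (fun _ => q.2) q.1 := by
    ext q
    by_cases hq : q.1 ∈ A <;> simp [hq]
  have hm := memLp_intensity hν2 (memLp_indicator_const 2 hA.1 (1 : ℝ)
    (Or.inr (leb_ne_top_of_mem_boundedBorel hA)))
  rw [h] at hm ⊢
  exact isL2Integral_l2Integral (hN.exists_isL2Integral hm)

lemma isL2Integral_simpleIntegral_levyNoise [SFinite ν] (hν2 : absMoment ν 2 < ∞)
    (hN : IsPoissonRandomMeasure P (intensity d ν) N) {g : Set (SpaceTime d) →₀ ℝ}
    (hg : ∀ A ∈ g.support, A ∈ boundedBorel d) :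
    IsL2Integral P (intensity d ν) {F | MeasurableSet F ∧ intensity d ν F ≠ ∞}
      (compensated (intensity d ν) N) (fun q => q.2 * simpleFunction g q.1)
      (simpleIntegral (levyNoise P ν N) g) := by
  classical
  rw [simpleIntegral_eq_sum, simpleFunction_eq_sum]
  have key : ∀ s : Finset (Set (SpaceTime d)), s ⊆ g.support →
      IsL2Integral P (intensity d ν) {F | MeasurableSet F ∧ intensity d ν F ≠ ∞}
      (compensated (intensity d ν) N)
      (fun q => q.2 * ∑ A ∈ s, g A * A.indicator (fun _ => (1 : ℝ)) q.1)
      (fun ω => ∑ A ∈ s, g A * levyNoise P ν N A ω) := by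
    intro s
    induction s using Finset.induction_on with
    | empty =>
      intro _
      refine ⟨by simp, fun _ => 0, by simp, ?_, ?_⟩ <;> simp [simpleFunction, simpleIntegral]
    | insert A s hAs ih =>
      intro hs
      have hmem : ∀ B ∈ insert A s, MemLp
          (fun q : SpaceTime d => g B * B.indicator (fun _ => (1 : ℝ)) q) 2 (leb d) := fun B hB =>
        (memLp_indicator_const 2 (hg B (hs hB)).1 (1 : ℝ)
          (Or.inr (leb_ne_top_of_mem_boundedBorel (hg B (hs hB))))).const_mul _
      have hsum : MemLp (fun q : SpaceTime d =>
          ∑ B ∈ s, g B * B.indicator (fun _ => (1 : ℝ)) q) 2 (leb d) :=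
        memLp_finsetSum s fun B hB => hmem B (Finset.mem_insert_of_mem hB)
      have hA := hg A (hs (Finset.mem_insert_self A s))
      have h1 := hN.isScaledIsometry_compensated.isL2Integral_add
        ((memLp_intensity hν2 (memLp_indicator_const 2 hA.1 (1 : ℝ)
          (Or.inr (leb_ne_top_of_mem_boundedBorel hA)))).const_smul (g A))
        (memLp_intensity hν2 hsum)
        (IsScaledIsometry.isL2Integral_smul (g A) (isL2Integral_levyNoise hν2 hN hA))
        (ih ((Finset.subset_insert A s).trans hs))
      convert h1 using 1
      · ext q
        simp only [Finset.sum_insert hAs, Pi.add_apply, Pi.smul_apply, smul_eq_mul]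
        ring
      · ext ω
        simp [Finset.sum_insert hAs]
  exact key _ subset_rfl

/-- The Lévy white noise scales the `L²` norm by `√m₂`. -/
lemma isScaledIsometry_levyNoise [SFinite ν] (hν2 : absMoment ν 2 < ∞)
    (hN : IsPoissonRandomMeasure P (intensity d ν) N) :
    IsScaledIsometry P (leb d) (boundedBorel d) (levyNoise P ν N)
      (absMoment ν 2 ^ (2⁻¹ : ℝ)) where
  measurableSet A hA := hA.1
  measure_ne_top A hA := leb_ne_top_of_mem_boundedBorel hA
  memLp A hA := (isL2Integral_levyNoise hν2 hN hA).1
  ne_top := (ENNReal.rpow_lt_top_of_nonneg (by norm_num) hν2.ne).ne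
  eLpNorm_eq g hg := by
    have hm : MemLp (simpleFunction g) 2 (leb d) := memLp_simpleFunction
      (fun A hA => ⟨hA.1, leb_ne_top_of_mem_boundedBorel hA⟩) hg
    rw [hN.isScaledIsometry_compensated.eLpNorm_isL2Integral (memLp_intensity hν2 hm)
      (isL2Integral_simpleIntegral_levyNoise hν2 hN hg), one_mul,
      eLpNorm_intensity hm.1.aemeasurable]

/-- `∫ φ dL` is the integral of `z φ(t, x)` with respect to the compensated Poisson measure. -/
lemma isL2Integral_levyIntegral [SFinite ν] (hν2 : absMoment ν 2 < ∞)
    (hN : IsPoissonRandomMeasure P (intensity d ν) N) {φ : SpaceTime d → ℝ}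
    (hφ : MemLp φ 2 (leb d)) :
    IsL2Integral P (intensity d ν) {F | MeasurableSet F ∧ intensity d ν F ≠ ∞}
      (compensated (intensity d ν) N) (fun q => q.2 * φ q.1) (levyIntegral P ν N φ) := by
  have hL := isScaledIsometry_levyNoise hν2 hN
  obtain ⟨g₀, hg₀, hgt₀⟩ := exists_tendsto_boundedBorel hφ
  have hex := hL.exists_isL2Integral hφ g₀ hg₀ hgt₀
  obtain ⟨hX, g, hg, hgf, hgX⟩ : IsL2Integral P (leb d) (boundedBorel d) (levyNoise P ν N) φ
    (levyIntegral P ν N φ) := isL2Integral_l2Integral hex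
  -- For simple `φ` the two integrals agree. The product structure of the intensity turns `g n → φ`
  -- into `z g n → z φ` in `L²`, and compensated integrals are closed under such limits.
  refine hN.isScaledIsometry_compensated.isL2Integral_of_tendsto
    (fun n => memLp_intensity hν2 (hL.memLp_simpleFunction (hg n))) (memLp_intensity hν2 hφ) hX
    (fun n => isL2Integral_simpleIntegral_levyNoise hν2 hN (hg n)) ?_ hgX
  have h1 := ENNReal.Tendsto.const_mul (a := absMoment ν 2 ^ (2⁻¹ : ℝ)) hgf (Or.inr hL.ne_top)
  rw [mul_zero] at h1
  refine h1.congr fun n => ?_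
  have h2 := eLpNorm_intensity (ν := ν)
    ((hL.memLp_simpleFunction (hg n)).sub hφ).1.aemeasurable
  simp only [Pi.sub_apply, mul_sub] at h2
  exact h2.symm

end LevyNoise

/-! ### Restriction to the time strip, and elementary moment bounds. -/

section TimeStrip

variable {d : ℕ} {T : ℝ} {Φ : SpaceTime d → ℝ}

lemma measurableSet_timeStrip (d : ℕ) (T : ℝ) : MeasurableSet (timeStrip d T) :=
  measurableSet_Icc.prod MeasurableSet.univ

lemma leb_restrict_timeStrip (d : ℕ) (T : ℝ) :
    (leb d).restrict (timeStrip d T) = volume.restrict (timeStrip d T) := by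
  rw [leb, Measure.restrict_restrict (measurableSet_timeStrip d T),
    inter_eq_left.2 (show timeStrip d T ⊆ halfSpace d from
      prod_mono Icc_subset_Ici_self subset_rfl)]

lemma memLp_indicator_timeStrip {p : ℝ≥0∞} :
    MemLp ((timeStrip d T).indicator Φ) p (leb d)
      ↔ MemLp Φ p (volume.restrict (timeStrip d T)) := by
  rw [memLp_indicator_iff_restrict (measurableSet_timeStrip d T), leb_restrict_timeStrip]

lemma lintegral_indicator_timeStrip {p : ℝ} (hp : 0 < p) :
    ∫⁻ s, ‖(timeStrip d T).indicator Φ s‖ₑ ^ p ∂(leb d)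
      = ∫⁻ s in timeStrip d T, ‖Φ s‖ₑ ^ p := by
  rw [← leb_restrict_timeStrip, ← lintegral_indicator (measurableSet_timeStrip d T)]
  refine lintegral_congr fun s => ?_
  by_cases hs : s ∈ timeStrip d T
  · simp [hs]
  · simp [hs, hp]

end TimeStrip

lemma isSubmultiplicative_one_add_abs_rpow {p : ℝ} (hp : 0 ≤ p) :
    IsSubmultiplicative fun x => (1 + |x|) ^ p :=
  ⟨1, one_pos, fun x y => by simpa using one_add_abs_rpow_add_le hp x y⟩

lemma one_add_rpow_le {p x : ℝ} (hp : 0 ≤ p) (hx : 0 ≤ x) :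
    (1 + x) ^ p ≤ 2 ^ p * (1 + x ^ p) := by
  rcases le_total x 1 with h | h
  · calc (1 + x) ^ p ≤ 2 ^ p := Real.rpow_le_rpow (by linarith) (by linarith) hp
      _ ≤ 2 ^ p * (1 + x ^ p) := le_mul_of_one_le_right (by positivity)
          (by linarith [Real.rpow_nonneg hx p])
  · calc (1 + x) ^ p ≤ (2 * x) ^ p := Real.rpow_le_rpow (by linarith) (by linarith) hp
      _ = 2 ^ p * x ^ p := Real.mul_rpow (by norm_num) hx
      _ ≤ 2 ^ p * (1 + x ^ p) := by gcongr; linarith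

/-- Passes between the moment in question and the submultiplicative weight; the added constant is
integrable because `P` is finite. -/
lemma lintegral_one_add_abs_rpow_lt_top_iff {Ω : Type*} [MeasurableSpace Ω] {P : Measure Ω}
    [IsFiniteMeasure P] {X : Ω → ℝ} {p : ℝ} (hp : 0 ≤ p) :
    ∫⁻ ω, ENNReal.ofReal ((1 + |X ω|) ^ p) ∂P < ∞ ↔ ∫⁻ ω, ENNReal.ofReal (|X ω| ^ p) ∂P < ∞ := by
  constructor <;> intro h
  · refine lt_of_le_of_lt (lintegral_mono fun ω => ENNReal.ofReal_le_ofReal ?_) h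
    exact Real.rpow_le_rpow (abs_nonneg _) (by linarith) hp
  · refine lt_of_le_of_lt (lintegral_mono (g := fun ω => ENNReal.ofReal (2 ^ p)
      * (1 + ENNReal.ofReal (|X ω| ^ p))) fun ω => ?_) ?_
    · simp only
      rw [← ENNReal.ofReal_one, ← ENNReal.ofReal_add zero_le_one (by positivity),
        ← ENNReal.ofReal_mul (by positivity)]
      exact ENNReal.ofReal_le_ofReal (one_add_rpow_le hp (abs_nonneg _))
    · rw [lintegral_const_mul' _ _ ENNReal.ofReal_ne_top, lintegral_add_left measurable_const]
      refine ENNReal.mul_lt_top ENNReal.ofReal_lt_top (ENNReal.add_lt_top.2 ⟨?_, h⟩)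
      simp

lemma absMoment_ne_zero {ν : Measure ℝ} (hν : IsLevyMeasure ν) (h0 : ν ≠ 0) (p : ℝ) :
    absMoment ν p ≠ 0 := by
  intro h
  rw [absMoment, lintegral_eq_zero_iff (by fun_prop)] at h
  have hne : ∀ᵐ z ∂ν, z ≠ 0 := measure_eq_zero_iff_ae_notMem.1 hν.zero
  refine h0 (ae_eq_bot.1 (Filter.eventually_false_iff_eq_bot.1 ?_))
  filter_upwards [h, hne] with z hz hz'
  have : 0 < |z| ^ p := Real.rpow_pos_of_pos (abs_pos.2 hz') p
  exact absurd hz (by simpa using this)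

end

/-! ### The main theorem. -/

theorem corollary2 {Ω : Type*} [MeasurableSpace Ω] (P : Measure Ω) [IsProbabilityMeasure P]
    (d : ℕ) (ν : Measure ℝ) (hν : IsLevyMeasure ν) (hν2 : absMoment ν 2 < ∞)
    (N : Ω → Measure (SpaceTime d × ℝ)) (hN : IsPoissonRandomMeasure P (intensity d ν) N)
    (T : ℝ) (hT : 0 ≤ T) (Φ : SpaceTime d → ℝ)
    (hΦ : MemLp Φ 2 (volume.restrict (timeStrip d T))) :
    (∀ p : ℝ, 2 ≤ p →
      -- sufficiency, without any non-degeneracy assumption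
      ((MemLp Φ (ENNReal.ofReal p) (volume.restrict (timeStrip d T)) ∧ absMoment ν p < ∞) →
        ∫⁻ ω, ENNReal.ofReal (|levyIntegralOn P ν N T Φ ω| ^ p) ∂P < ∞) ∧
      -- the equivalence, for non-zero noise and non-zero integrand
      (ν ≠ 0 → ¬ (Φ =ᵐ[volume.restrict (timeStrip d T)] 0) →
        (∫⁻ ω, ENNReal.ofReal (|levyIntegralOn P ν N T Φ ω| ^ p) ∂P < ∞ ↔
          MemLp Φ (ENNReal.ofReal p) (volume.restrict (timeStrip d T)) ∧ absMoment ν p < ∞))) ∧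
    (∀ g : ℝ → ℝ, Measurable g → (∀ x, 0 ≤ g x) → LocallyIntegrable g volume →
      IsSubmultiplicative g →
      ∫⁻ ω, ENNReal.ofReal (g (levyIntegralOn P ν N T Φ ω)) ∂P < ∞ →
      ∫⁻ s in timeStrip d T, ∫⁻ z in {z : ℝ | 1 < |z * Φ s|},
        ENNReal.ofReal (g (z * Φ s)) ∂ν < ∞) := by
  have := hν.sFinite
  have hφ₀ : MemLp ((timeStrip d T).indicator Φ) 2 (leb d) := memLp_indicator_timeStrip.2 hΦ
  have hZ₀ := isL2Integral_levyIntegral hν2 hN hφ₀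
  -- The decomposition by `{|f| > 1}` needs a genuinely measurable integrand, so a measurable
  -- version of `Φ` on the strip is used.
  obtain ⟨φ, hφm, hφe⟩ : ∃ φ : SpaceTime d → ℝ, Measurable φ ∧
      (timeStrip d T).indicator Φ =ᵐ[leb d] φ :=
    ⟨hφ₀.1.mk _, hφ₀.1.stronglyMeasurable_mk.measurable, hφ₀.1.ae_eq_mk⟩
  set f : SpaceTime d × ℝ → ℝ := fun q => q.2 * φ q.1 with hf
  have hfm : Measurable f := by fun_prop
  have hf2 : MemLp f 2 (intensity d ν) := memLp_intensity hν2 (hφ₀.ae_eq hφe)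
  have hZ : IsL2Integral P (intensity d ν) {F | MeasurableSet F ∧ intensity d ν F ≠ ∞}
      (compensated (intensity d ν) N) f (levyIntegralOn P ν N T Φ) := by
    refine hZ₀.congr ?_
    filter_upwards [Measure.quasiMeasurePreserving_fst.ae hφe] with q hq
    simp only [hf, hq]
  have hmom : ∀ p : ℝ, 0 < p → ∫⁻ q, ENNReal.ofReal (|f q| ^ p) ∂(intensity d ν)
      = (∫⁻ s in timeStrip d T, ‖Φ s‖ₑ ^ p) * absMoment ν p := by
    intro p hp
    rw [← lintegral_indicator_timeStrip hp, lintegral_congr_ae (hφe.mono fun s hs => by rw [hs]),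
      ← lintegral_intensity_rpow hφm.aemeasurable hp.le]
    refine lintegral_congr fun q => ?_
    rw [Real.enorm_eq_ofReal_abs, ENNReal.ofReal_rpow_of_nonneg (abs_nonneg _) hp.le]
  have hLp : ∀ p : ℝ, 0 < p → (MemLp Φ (ENNReal.ofReal p) (volume.restrict (timeStrip d T)) ↔
      ∫⁻ s in timeStrip d T, ‖Φ s‖ₑ ^ p < ∞) := by
    intro p hp
    rw [MemLp, eLpNorm_lt_top_iff_lintegral_rpow_enorm_lt_top (by simpa using hp)
      ENNReal.ofReal_ne_top, ENNReal.toReal_ofReal hp.le]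
    exact and_iff_right hΦ.1
  have hD : MeasurableSet {q | 1 < |f q|} := measurableSet_lt measurable_const hfm.norm
  have hsuff : ∀ p : ℝ, 2 ≤ p →
      (MemLp Φ (ENNReal.ofReal p) (volume.restrict (timeStrip d T)) ∧ absMoment ν p < ∞) →
        ∫⁻ ω, ENNReal.ofReal (|levyIntegralOn P ν N T Φ ω| ^ p) ∂P < ∞ := by
    rintro p hp ⟨h1, h2⟩
    have hp0 : 0 < p := by linarith
    rw [hLp p hp0] at h1
    refine (lintegral_one_add_abs_rpow_lt_top_iff hp0.le).1
      (hN.lintegral_rpow_lt_top hfm hf2 hZ hp ?_)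
    rw [hmom p hp0]
    exact ENNReal.mul_lt_top h1 h2
  refine ⟨fun p hp => ⟨hsuff p hp, fun hν0 hΦ0 => ⟨fun h => ?_, hsuff p hp⟩⟩, ?_⟩
  · have hp0 : 0 < p := by linarith
    have h1 := hN.setLIntegral_lt_top hfm hf2 hZ (g := fun x => (1 + |x|) ^ p) (by fun_prop)
      (fun x => by positivity) (isSubmultiplicative_one_add_abs_rpow hp0.le)
      ((lintegral_one_add_abs_rpow_lt_top_iff hp0.le).2 h)
    have h2 : ∫⁻ q, ENNReal.ofReal (|f q| ^ p) ∂(intensity d ν) < ∞ := by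
      rw [← lintegral_add_compl _ hD]
      refine ENNReal.add_lt_top.2 ⟨lt_of_le_of_lt (lintegral_mono fun q =>
        ENNReal.ofReal_le_ofReal ?_) h1, ?_⟩
      · exact Real.rpow_le_rpow (abs_nonneg _) (by linarith) hp0.le
      -- Where `|f| ≤ 1`, `|f|^p ≤ |f|²` since `p ≥ 2`, and `f ∈ L²`.
      · refine lt_of_le_of_lt ((setLIntegral_mono' hD.compl fun q hq => ?_).trans
          (lintegral_mono' Measure.restrict_le_self le_rfl))
          (lintegral_rpow_enorm_lt_top_of_eLpNorm_lt_top (two_ne_zero' ℝ≥0∞)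
            ENNReal.ofNat_ne_top hf2.2)
        rw [Real.enorm_eq_ofReal_abs, ENNReal.ofReal_rpow_of_nonneg (abs_nonneg _) (by norm_num)]
        refine ENNReal.ofReal_le_ofReal ?_
        rcases (abs_nonneg (f q)).eq_or_lt with h0 | h0
        · rw [← h0, Real.zero_rpow hp0.ne']
          exact Real.rpow_nonneg le_rfl _
        · exact Real.rpow_le_rpow_of_exponent_ge h0 (not_lt.1 hq) (by simpa using hp)
    -- Non-degeneracy enters here: in `[0, ∞]` a finite product forces finite factors once neither
    -- is zero.
    have h3 : (∫⁻ s in timeStrip d T, ‖Φ s‖ₑ ^ p) ≠ 0 := by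
      intro h0
      rw [lintegral_eq_zero_iff' (hΦ.1.enorm.pow_const p)] at h0
      refine hΦ0 (h0.mono fun s hs => ?_)
      simpa [hp0, hp0.le] using hs
    rw [hmom p hp0] at h2
    rw [hLp p hp0]
    constructor
    · by_contra hne
      rw [not_lt_top_iff.1 hne, ENNReal.top_mul (absMoment_ne_zero hν hν0 p)] at h2
      exact lt_irrefl _ h2
    · by_contra hne
      rw [not_lt_top_iff.1 hne, ENNReal.mul_top h3] at h2
      exact lt_irrefl _ h2
  · intro g hg hg0 _ hsub hgZ
    have h1 := hN.setLIntegral_lt_top hfm hf2 hZ hg hg0 hsub hgZ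
    rw [← lintegral_indicator hD, intensity, lintegral_prod _
      ((Measurable.indicator (by fun_prop) hD).aemeasurable)] at h1
    -- After Tonelli, restricting the outer integral to the strip can only decrease it, and there `φ
    -- = Φ` almost everywhere.
    refine lt_of_le_of_lt (le_trans (le_of_eq ?_)
      (lintegral_mono' (Measure.restrict_le_self (s := timeStrip d T)) le_rfl)) h1
    rw [leb_restrict_timeStrip]
    have hφe' : ∀ᵐ s ∂(volume.restrict (timeStrip d T)), Φ s = φ s := by
      rw [← leb_restrict_timeStrip]
      filter_upwards [ae_restrict_of_ae hφe, ae_restrict_mem (measurableSet_timeStrip d T)]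
        with s h2 h3
      rw [← h2, indicator_of_mem h3]
    refine lintegral_congr_ae (hφe'.mono fun s hs => ?_)
    simp only [hs]
    have hDs : MeasurableSet {z : ℝ | 1 < |z * φ s|} :=
      measurableSet_lt measurable_const (by fun_prop)
    rw [← lintegral_indicator hDs]
    rfl
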